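/- **Definitions.** A function $f:\mathbb R^d\to[0,\infty)$ is a *proper log-concave function* if $f=e^{-\psi}$ for a convex $\psi:\mathbb R^d\to\mathbb R\cup\{\infty\}$, $f$ is upper semicontinuous, and $0<\int_{\mathbb R^d} f<\infty$. Let $\|f\|$ denote its $L_\infty$ norm. For $s>0$, the *$s$-lifting* of $f$ is the set $\{(x,\xi)\in\mathbb R^{d}\times\mathbb R:\ |\xi|\le f(x)^{1/s}\}$. For a Borel set $C\subseteq\mathbb R^{d}\times\mathbb R=\mathbb R^{d+1}$ that is symmetric about $\mathbb R^d$, the *$s$-marginal* of $C$ is the measure on $\mathbb R^d$ with density $$x\mapsto\Big[\tfrac12\,\mathrm{length}\big(C\cap(\{x\}\times\mathbb R)\big)\Big]^s,$$ and the *$s$-volume* $\mu_s(C)$ of $C$ is the integral of this density over $\mathbb R^d$. For a positive definite $A\in\mathbb R^{d\times d}$, $\alpha>0$ and $a\in\mathbb R^d$, the triple $(A,\alpha,a)$ represents the ellipsoid $(A\oplus\alpha)B^{d+1}+a$ in $\mathbb R^{d+1}$, where $B^{d+1}$ is the closed Euclidean unit ball; these are exactly the ellipsoids symmetric about $\mathbb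 R^d$. It also represents the *Gaussian density* $x\mapsto\alpha\, e^{-\langle A^{-1}(x-a),A^{-1}(x-a)\rangle}$ of *height* $\alpha$. The *John $s$-ellipsoid* $E_s(f)$ is the ellipsoid of maximal $s$-volume among those that are symmetric about $\mathbb R^d$ and contained in the $s$-lifting of $f$; the *John $s$-function* $J_s(f)$ is the density of the $s$-marginal of $E_s(f)$. A function $g$ is *below* $f$ if $g(x)\le f(x)$ for all $x\in\mathbb R^d$. **Theorem 7.4.** Let $f:\mathbb R^d\to[0,\infty)$ be a proper log-concave function. For every $s>0$ the John $s$-ellipsoid $E_s(f)$ exists and is unique, and the following hold. 1. There is a Gaussian density below $f$ if and only if $\limsup_{s\to\infty}\mu_s(E_s(f))>0$. 2. If there is a Gaussian density below $f$, then $\lim_{s\to\infty}\mu_s(E_s(f))$ exists, is finite and equals $\limsup_{s\to\infty}\mu_s(E_s(f))$, and there is a sequence $(s_i)$ of positive reals with $s_i\to\infty$ such that the John $s_i$-functions $J_{s_i}(f)$ converge uniformly on $\mathbb R^d$ to a Gaussian density which is of maximal integral among those Gaussian densities that are below $f$. 3. If there is a Gaussian density below $f$, then any Gaussian density which is of maximal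 integral among those Gaussian densities that are below $f$ is of height at least $e^{-d}\|f\|$. -/

import Mathlib

open MeasureTheory Filter Topology
open scoped ENNReal

/-- `f : ℝᵈ → ℝ` is log-concave, i.e. `f = exp (-ψ)` for a convex `ψ : ℝᵈ → ℝ ∪ {∞}`:
it is nonnegative and `f x ^ (1 - t) * f y ^ t ≤ f ((1 - t) x + t y)`. -/
def IsLogConcave {d : ℕ} (f : EuclideanSpace ℝ (Fin d) → ℝ) : Prop :=
  (∀ x, 0 ≤ f x) ∧
    ∀ x y : EuclideanSpace ℝ (Fin d), ∀ t : ℝ, 0 ≤ t → t ≤ 1 →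
      f x ^ (1 - t) * f y ^ t ≤ f ((1 - t) • x + t • y)

/-- Proper log-concave functions: log-concave, upper semicontinuous, with finite positive
integral. -/
structure IsProperLogConcave {d : ℕ} (f : EuclideanSpace ℝ (Fin d) → ℝ) : Prop where
  logConcave : IsLogConcave f
  usc : UpperSemicontinuous f
  integrable : Integrable f
  integral_pos : 0 < ∫ x, f x

/-- The `s`-lifting of `f`, a subset of `ℝᵈ⁺¹ = ℝᵈ × ℝ`. -/
def sLift {d : ℕ} (s : ℝ) (f : EuclideanSpace ℝ (Fin d) → ℝ) :
    Set (EuclideanSpace ℝ (Fin d) × ℝ) :=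
  {p | |p.2| ≤ f p.1 ^ (1 / s)}

/-- The density `x ↦ (½ length (C ∩ ℓ_x)) ^ s` of the `s`-marginal on `ℝᵈ` of a set
`C ⊆ ℝᵈ × ℝ`, where `ℓ_x` is the vertical line over `x`. -/
noncomputable def sMarginalDensity {d : ℕ} (s : ℝ)
    (C : Set (EuclideanSpace ℝ (Fin d) × ℝ)) (x : EuclideanSpace ℝ (Fin d)) : ℝ≥0∞ :=
  (volume {ξ : ℝ | (x, ξ) ∈ C} / 2) ^ s

/-- The `s`-volume of a set `C ⊆ ℝᵈ × ℝ`. -/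
noncomputable def sVolume {d : ℕ} (s : ℝ) (C : Set (EuclideanSpace ℝ (Fin d) × ℝ)) : ℝ≥0∞ :=
  ∫⁻ x, sMarginalDensity s C x

/-- The parameters `(A ⊕ α, a)`, with `A` a positive definite matrix, `α > 0` and `a ∈ ℝᵈ`.
They represent the ellipsoids in `ℝᵈ⁺¹` that are symmetric about `ℝᵈ`, and also the Gaussian
densities on `ℝᵈ`, in both cases in a unique way. -/
structure EllipsoidParam (d : ℕ) where
  A : Matrix (Fin d) (Fin d) ℝ
  α : ℝ
  a : EuclideanSpace ℝ (Fin d)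
  posDef : A.PosDef
  α_pos : 0 < α

/-- The closed Euclidean unit ball of `ℝᵈ⁺¹ = ℝᵈ × ℝ`. -/
def unitBall (d : ℕ) : Set (EuclideanSpace ℝ (Fin d) × ℝ) :=
  {p | ‖p.1‖ ^ 2 + p.2 ^ 2 ≤ 1}

/-- The ellipsoid `(A ⊕ α) B + a`, where `B` is the unit ball of `ℝᵈ⁺¹`. -/
def EllipsoidParam.body {d : ℕ} (E : EllipsoidParam d) :
    Set (EuclideanSpace ℝ (Fin d) × ℝ) :=
  (fun p => (Matrix.toEuclideanLin E.A p.1 + E.a, E.α * p.2)) '' unitBall d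

/-- The Gaussian density `x ↦ α exp (-⟨A⁻¹ (x - a), A⁻¹ (x - a)⟩)`. -/
noncomputable def EllipsoidParam.gaussian {d : ℕ} (G : EllipsoidParam d)
    (x : EuclideanSpace ℝ (Fin d)) : ℝ :=
  G.α * Real.exp (-inner ℝ (Matrix.toEuclideanLin G.A⁻¹ (x - G.a))
    (Matrix.toEuclideanLin G.A⁻¹ (x - G.a)))

/-- `E` is the John `s`-ellipsoid of `f`: it has maximal `s`-volume among the ellipsoids in
`ℝᵈ⁺¹` that are symmetric about `ℝᵈ` and contained in the `s`-lifting of `f`. -/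
def IsJohnEllipsoid {d : ℕ} (s : ℝ) (f : EuclideanSpace ℝ (Fin d) → ℝ)
    (E : EllipsoidParam d) : Prop :=
  E.body ⊆ sLift s f ∧
    ∀ E' : EllipsoidParam d, E'.body ⊆ sLift s f → sVolume s E'.body ≤ sVolume s E.body

/-- The real-valued density of the `s`-marginal of an ellipsoid `E`. It is the John `s`-function
of `f` when `E` is the John `s`-ellipsoid of `f`. -/
noncomputable def EllipsoidParam.sFunction {d : ℕ} (s : ℝ) (E : EllipsoidParam d)
    (x : EuclideanSpace ℝ (Fin d)) : ℝ :=
  (sMarginalDensity s E.body x).toReal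

/-- The Gaussian density represented by `G` is below `f`. -/
def EllipsoidParam.GaussianBelow {d : ℕ} (G : EllipsoidParam d)
    (f : EuclideanSpace ℝ (Fin d) → ℝ) : Prop :=
  ∀ x, G.gaussian x ≤ f x

/-- The Gaussian density represented by `G` has maximal integral among those below `f`. -/
def EllipsoidParam.IsMaximalGaussian {d : ℕ} (G : EllipsoidParam d)
    (f : EuclideanSpace ℝ (Fin d) → ℝ) : Prop :=
  G.GaussianBelow f ∧
    ∀ G' : EllipsoidParam d, G'.GaussianBelow f → ∫ x, G'.gaussian x ≤ ∫ x, G.gaussian x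

/-! ### Positive definite matrices -/

/-! Everything is one extremal problem: for a fixed profile `φ`, maximise the weight `α det A` over
all transported copies `x ↦ α φ(A⁻¹(x - a))` that lie below `f`. The integral of such a copy is its
weight times `∫ φ`. With `φ = (1 - ‖y‖²)₊^(s/2)` the maximisers are the John `s`-ellipsoids, their
height `α` being replaced by `α ^ s` (`isJohnEllipsoid_iff`). With `φ = exp (-‖y‖²)` they are the
Gaussian densities of maximal integral (`isMaximalGaussian_iff`).

Compactness (`exists_subseq_tendsto`): a copy of weight at least `c` below `f` puts a fixed amount
of mass on the image of any small ball. As `f` is bounded with small tails, this confines `A`, `α`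
and `a`. The lower bound on the weight keeps the limit nondegenerate, and upper semicontinuity keeps
it below `f`.

Uniqueness: averaging two maximisers (arithmetic mean of `A`, geometric mean of `α`) stays below `f`
by log-concavity, so strict log-concavity of the determinant forces equal `A` and `α`. If the
profile has bounded support, two different centres leave room to stretch `A` along their difference.

Limit: dilating `y` by `√(2/s)` only reparametrises the problem and turns the profile into `(1 -
2‖y‖²/s)₊^(s/2)`, which lies below the Gaussian profile and tends to it uniformly. So a Gaussian
below `f` competes for every `s`, while limits of maximisers are Gaussians below `f`. The two
comparisons identify the limit of the weights with the maximal Gaussian weight.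

Height: halfway interpolation between a maximal Gaussian and a value `f x` gives a competing
Gaussian, whence `f x ≤ 2ᵈ α`, and `2 ≤ e`. -/

theorem toEuclideanLin_mul_apply {d : ℕ} (A B : Matrix (Fin d) (Fin d) ℝ)
    (x : EuclideanSpace ℝ (Fin d)) :
    Matrix.toEuclideanLin (A * B) x = Matrix.toEuclideanLin A (Matrix.toEuclideanLin B x) := by
  simp [Matrix.toLpLin_mul_same]

theorem toEuclideanLin_inv_apply {d : ℕ} {A : Matrix (Fin d) (Fin d) ℝ} (hA : A.PosDef)
    (x : EuclideanSpace ℝ (Fin d)) :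
    Matrix.toEuclideanLin A⁻¹ (Matrix.toEuclideanLin A x) = x := by
  rw [← toEuclideanLin_mul_apply,
    Matrix.nonsing_inv_mul _ ((Matrix.isUnit_iff_isUnit_det A).1 hA.isUnit)]
  simp

theorem toEuclideanLin_apply_inv {d : ℕ} {A : Matrix (Fin d) (Fin d) ℝ} (hA : A.PosDef)
    (x : EuclideanSpace ℝ (Fin d)) :
    Matrix.toEuclideanLin A (Matrix.toEuclideanLin A⁻¹ x) = x := by
  rw [← toEuclideanLin_mul_apply,
    Matrix.mul_nonsing_inv _ ((Matrix.isUnit_iff_isUnit_det A).1 hA.isUnit)]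
  simp

theorem inner_toEuclideanLin_comm {d : ℕ} {A : Matrix (Fin d) (Fin d) ℝ} (hA : A.IsHermitian)
    (x y : EuclideanSpace ℝ (Fin d)) :
    inner ℝ (Matrix.toEuclideanLin A x) y = inner ℝ x (Matrix.toEuclideanLin A y) :=
  Matrix.isSymmetric_toEuclideanLin_iff.2 hA x y

/-- The characteristic polynomial evaluated at `-1`; the sign `(-1)ⁿ` occurs on both sides and
cancels. -/
theorem det_midpoint_one {n : Type*} [Fintype n] [DecidableEq n] {C : Matrix n n ℝ}
    (hC : C.IsHermitian) :
    ((1 / 2 : ℝ) • (1 + C)).det = ∏ i, (1 + hC.eigenvalues i) / 2 := by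
  have h1 := congrArg (Polynomial.eval (-1)) hC.charpoly_eq
  rw [Matrix.eval_charpoly, Polynomial.eval_prod] at h1
  have h2 : Matrix.scalar n (-1 : ℝ) - C = -(1 + C) := by
    rw [map_neg, map_one]; abel
  rw [h2, Matrix.det_neg] at h1
  have h3 : ∏ i, Polynomial.eval (-1 : ℝ)
      (Polynomial.X - Polynomial.C (RCLike.ofReal (hC.eigenvalues i) : ℝ)) =
      (-1) ^ Fintype.card n * ∏ i, (1 + hC.eigenvalues i) := by
    rw [Fintype.card, ← Finset.prod_const, ← Finset.prod_mul_distrib]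
    refine Finset.prod_congr rfl fun i _ => ?_
    simp
    ring
  rw [h3] at h1
  have h4 := mul_left_cancel₀ (pow_ne_zero _ (by norm_num : (-1 : ℝ) ≠ 0)) h1
  rw [Matrix.det_smul, h4, Finset.prod_div_distrib, Finset.prod_const, Finset.card_univ, one_div,
    inv_pow]
  field_simp

theorem eq_one_of_eigenvalues_eq_one {n : Type*} [Fintype n] [DecidableEq n] {C : Matrix n n ℝ}
    (hC : C.IsHermitian) (h : ∀ i, hC.eigenvalues i = 1) : C = 1 := by
  have h1 := hC.spectral_theorem
  have h2 : (RCLike.ofReal ∘ hC.eigenvalues : n → ℝ) = fun _ => 1 := by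
    ext i; simp [h i]
  rw [h2, Matrix.diagonal_one, map_one] at h1
  exact h1

open scoped Matrix MatrixOrder Matrix.Norms.L2Operator in
/-- The determinant is strictly log-concave along midpoints of positive definite matrices. -/
theorem Matrix.PosDef.det_midpoint {n : Type*} [Fintype n] [DecidableEq n]
    {A B : Matrix n n ℝ} (hA : A.PosDef) (hB : B.PosDef) :
    A.det * B.det ≤ ((1 / 2 : ℝ) • (A + B)).det ^ 2 ∧
      (A.det * B.det = ((1 / 2 : ℝ) • (A + B)).det ^ 2 → A = B) := by
  -- Writing `A = Pᴴ P` and `B = Pᴴ C P` reduces the claim to the pair `1`, `C`. There it is `λ ≤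
  -- ((1 + λ) / 2)²` for each eigenvalue of `C`, with equality only at `λ = 1`.
  obtain ⟨P, hPA⟩ := CStarAlgebra.nonneg_iff_eq_star_mul_self.mp hA.posSemidef.nonneg
  rw [Matrix.star_eq_conjTranspose] at hPA
  have hdetA : A.det = P.det ^ 2 := by
    rw [hPA, Matrix.det_mul, Matrix.det_conjTranspose]; simp [sq]
  have hP0 : P.det ≠ 0 := fun h => hA.det_pos.ne' (by rw [hdetA, h]; simp)
  have hPu : IsUnit P.det := isUnit_iff_ne_zero.2 hP0
  have hPH : IsUnit Pᴴ.det := by rw [Matrix.det_conjTranspose]; simpa using hP0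
  set C := P⁻¹ᴴ * B * P⁻¹ with hCdef
  have hinj : Function.Injective P⁻¹.mulVec :=
    Matrix.mulVec_injective_iff_isUnit.2 ((Matrix.isUnit_nonsing_inv_iff).2
      ((Matrix.isUnit_iff_isUnit_det P).2 hPu))
  have hC : C.PosDef := hB.conjTranspose_mul_mul_same hinj
  have hBC : B = Pᴴ * C * P := by
    rw [hCdef, Matrix.conjTranspose_nonsing_inv]
    simp only [← Matrix.mul_assoc, Matrix.mul_nonsing_inv _ hPH, Matrix.one_mul]
    rw [Matrix.mul_assoc, Matrix.nonsing_inv_mul _ hPu, Matrix.mul_one]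
  have hmid : (1 / 2 : ℝ) • (A + B) = Pᴴ * ((1 / 2 : ℝ) • (1 + C)) * P := by
    rw [Matrix.mul_smul, Matrix.smul_mul, Matrix.mul_add, Matrix.add_mul, ← hBC, Matrix.mul_one,
      ← hPA]
  have hdetm : ((1 / 2 : ℝ) • (A + B)).det = P.det ^ 2 * ∏ i, (1 + hC.1.eigenvalues i) / 2 := by
    rw [hmid, Matrix.det_mul, Matrix.det_mul, Matrix.det_conjTranspose, det_midpoint_one hC.1]
    simp only [star_trivial]
    ring
  have hdetB : B.det = P.det ^ 2 * ∏ i, hC.1.eigenvalues i := by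
    rw [hBC, Matrix.det_mul, Matrix.det_mul, Matrix.det_conjTranspose,
      hC.1.det_eq_prod_eigenvalues]
    simp only [star_trivial, RCLike.ofReal_real_eq_id, id_eq]
    ring
  have hpos : ∀ i, 0 < hC.1.eigenvalues i := fun i => hC.eigenvalues_pos i
  have hle : ∀ i, hC.1.eigenvalues i ≤ ((1 + hC.1.eigenvalues i) / 2) ^ 2 := fun i => by
    nlinarith [sq_nonneg (hC.1.eigenvalues i - 1)]
  have hP4 : 0 < P.det ^ 2 * P.det ^ 2 := by positivity
  have hlhs : A.det * B.det = P.det ^ 2 * P.det ^ 2 * ∏ i, hC.1.eigenvalues i := by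
    rw [hdetA, hdetB]; ring
  have hrhs : ((1 / 2 : ℝ) • (A + B)).det ^ 2 =
      P.det ^ 2 * P.det ^ 2 * ∏ i, ((1 + hC.1.eigenvalues i) / 2) ^ 2 := by
    rw [hdetm, Finset.prod_pow]; ring
  rw [hlhs, hrhs]
  refine ⟨mul_le_mul_of_nonneg_left
    (Finset.prod_le_prod (fun i _ => (hpos i).le) fun i _ => hle i) hP4.le, fun h => ?_⟩
  have hprod := mul_left_cancel₀ hP4.ne' h
  have hone : ∀ i, hC.1.eigenvalues i = 1 := by
    by_contra! hne
    obtain ⟨i, hi⟩ := hne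
    refine (Finset.prod_lt_prod (fun i _ => hpos i) (fun i _ => hle i)
      ⟨i, Finset.mem_univ i, ?_⟩).ne hprod
    have : 0 < (hC.1.eigenvalues i - 1) ^ 2 := by
      have := sub_ne_zero.2 hi
      positivity
    nlinarith
  rw [hBC, eq_one_of_eigenvalues_eq_one hC.1 hone, Matrix.mul_one, ← hPA]

-- By the matrix determinant lemma the determinant is multiplied by `1 + ε vᵀA⁻¹v > 1`.
open scoped Matrix in
theorem det_lt_det_add_vecMulVec {n : Type*} [Fintype n] [DecidableEq n] {A : Matrix n n ℝ}
    (hA : A.PosDef) {v : n → ℝ} (hv : v ≠ 0) {ε : ℝ} (hε : 0 < ε) :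
    A.det < (A + Matrix.vecMulVec (ε • v) v).det := by
  have hu : IsUnit A.det := (Matrix.isUnit_iff_isUnit_det A).1 hA.isUnit
  have h := hA.inv.dotProduct_mulVec_pos hv
  have : (A + Matrix.vecMulVec (ε • v) v).det = A.det * (1 + ε * (v ⬝ᵥ A⁻¹.mulVec v)) := by
    have hfac : A + Matrix.vecMulVec (ε • v) v = A * (1 + Matrix.replicateCol Unit
        (A⁻¹ *ᵥ (ε • v)) * Matrix.replicateRow Unit v) := by
      rw [← Matrix.vecMulVec_eq, Matrix.mul_add, Matrix.mul_one, Matrix.mul_vecMulVec,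
        Matrix.mulVec_mulVec, Matrix.mul_nonsing_inv _ hu, Matrix.one_mulVec]
    rw [hfac, Matrix.det_mul, Matrix.det_one_add_replicateCol_mul_replicateRow,
      Matrix.mulVec_smul, dotProduct_smul, smul_eq_mul]
  rw [this]
  have h3 : 0 < ε * (v ⬝ᵥ A⁻¹.mulVec v) := mul_pos hε (by simpa using h)
  nlinarith [hA.det_pos]

theorem posDef_add_vecMulVec {n : Type*} [Fintype n] [DecidableEq n] {A : Matrix n n ℝ}
    (hA : A.PosDef) (v : n → ℝ) {ε : ℝ} (hε : 0 < ε) :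
    (A + Matrix.vecMulVec (ε • v) v).PosDef := by
  refine hA.add_posSemidef ?_
  have := (Matrix.posSemidef_vecMulVec_self_star v).smul hε.le
  simpa [Matrix.smul_vecMulVec] using this

/-! ### Proper log-concave functions -/

theorem IsLogConcave.rpow_mul_rpow_le {d : ℕ} {f : EuclideanSpace ℝ (Fin d) → ℝ}
    (hf : IsLogConcave f) {x y : EuclideanSpace ℝ (Fin d)} {a b t : ℝ} (ha : 0 ≤ a) (hb : 0 ≤ b)
    (hax : a ≤ f x) (hby : b ≤ f y) (ht0 : 0 ≤ t) (ht1 : t ≤ 1) :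
    a ^ (1 - t) * b ^ t ≤ f ((1 - t) • x + t • y) :=
  (mul_le_mul (Real.rpow_le_rpow ha hax (by linarith)) (Real.rpow_le_rpow hb hby ht0)
    (Real.rpow_nonneg hb _) (Real.rpow_nonneg (ha.trans hax) _)).trans (hf.2 x y t ht0 ht1)

theorem IsLogConcave.le_of_le {d : ℕ} {f : EuclideanSpace ℝ (Fin d) → ℝ}
    (hf : IsLogConcave f) {x y : EuclideanSpace ℝ (Fin d)} {c t : ℝ}
    (hcx : c ≤ f x) (hcy : c ≤ f y) (ht0 : 0 ≤ t) (ht1 : t ≤ 1) :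
    c ≤ f ((1 - t) • x + t • y) := by
  rcases le_or_gt c 0 with hc | hc
  · exact hc.trans (hf.1 _)
  · have := hf.rpow_mul_rpow_le hc.le hc.le hcx hcy ht0 ht1
    rwa [← Real.rpow_add hc, sub_add_cancel, Real.rpow_one] at this

theorem IsLogConcave.convex_superlevel {d : ℕ} {f : EuclideanSpace ℝ (Fin d) → ℝ}
    (hf : IsLogConcave f) (c : ℝ) : Convex ℝ {x | c ≤ f x} := by
  intro x hx y hy a b ha hb hab
  have : a = 1 - b := by linarith
  subst this
  exact hf.le_of_le hx hy hb (by linarith)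

/-- Were every superlevel set `{f ≥ 1/(n+1)}` without interior, each of them, being convex, would
lie in its own frontier, a null set. Then `f` would vanish almost everywhere. -/
theorem IsProperLogConcave.exists_pos_closedBall {d : ℕ} {f : EuclideanSpace ℝ (Fin d) → ℝ}
    (hf : IsProperLogConcave f) :
    ∃ (x₀ : EuclideanSpace ℝ (Fin d)) (r m : ℝ), 0 < r ∧ 0 < m ∧
      ∀ x ∈ Metric.closedBall x₀ r, m ≤ f x := by
  by_contra! hcon
  have hint : ∀ n : ℕ, interior {x | 1 / ((n : ℝ) + 1) ≤ f x} = ∅ := by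
    intro n
    by_contra hne
    obtain ⟨x₀, hx₀⟩ := Set.nonempty_iff_ne_empty.2 hne
    obtain ⟨r, hr, hball⟩ := Metric.isOpen_iff.1 isOpen_interior x₀ hx₀
    obtain ⟨x, hx, hlt⟩ := hcon x₀ (r / 2) (1 / ((n : ℝ) + 1)) (by positivity) (by positivity)
    have : x ∈ Metric.ball x₀ r := Metric.closedBall_subset_ball (by linarith) hx
    exact absurd (interior_subset (hball this)) (not_le.2 hlt)
  have hnull : ∀ n : ℕ, volume {x | 1 / ((n : ℝ) + 1) ≤ f x} = 0 := by
    intro n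
    refine measure_mono_null (fun x hx => ?_)
      ((hf.logConcave.convex_superlevel (1 / ((n : ℝ) + 1))).addHaar_frontier volume)
    rw [frontier, hint n, Set.sdiff_empty]
    exact subset_closure hx
  have hae : ∀ᵐ x, f x = 0 := by
    refine measure_mono_null (fun x hx => ?_) (measure_iUnion_null hnull)
    have hpos : 0 < f x := lt_of_le_of_ne (hf.logConcave.1 x) (Ne.symm hx)
    obtain ⟨n, hn⟩ := exists_nat_one_div_lt hpos
    exact Set.mem_iUnion.2 ⟨n, hn.le⟩
  have := hf.integral_pos
  rw [integral_congr_ae hae] at this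
  simp at this

/-- On the ball halfway between `z` and a ball where `f ≥ m`, log-concavity gives `f ≥ √(f z * m)`.
Markov's inequality bounds this by `∫ f` over the volume of the halfway ball, which does not depend
on `z`. -/
theorem IsProperLogConcave.exists_bound {d : ℕ} {f : EuclideanSpace ℝ (Fin d) → ℝ}
    (hf : IsProperLogConcave f) : ∃ C : ℝ, 0 < C ∧ ∀ x, f x ≤ C := by
  obtain ⟨x₀, r, m, hr, hm, hball⟩ := hf.exists_pos_closedBall
  set V := volume.real (Metric.closedBall (0 : EuclideanSpace ℝ (Fin d)) (r / 2)) with hV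
  have hVpos : 0 < V := by
    rw [hV]
    exact ENNReal.toReal_pos (Metric.measure_closedBall_pos _ _ (by positivity)).ne'
      measure_closedBall_lt_top.ne
  refine ⟨((∫ x, f x) / V) ^ 2 / m, div_pos (pow_pos (div_pos hf.integral_pos hVpos) 2) hm,
    fun z => ?_⟩
  rcases (hf.logConcave.1 z).eq_or_lt with h0 | h0
  · rw [← h0]; positivity
  have hs : 0 < √(f z * m) := Real.sqrt_pos.2 (mul_pos h0 hm)
  have hsub : Metric.closedBall ((1 / 2 : ℝ) • z + (1 / 2 : ℝ) • x₀) (r / 2) ⊆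
      {x | √(f z * m) ≤ f x} := by
    intro y hy
    -- `y` is the midpoint of `z` and `2y - z`.
    have hw : (2 : ℝ) • y - z ∈ Metric.closedBall x₀ r := by
      rw [mem_closedBall_iff_norm] at hy ⊢
      have : (2 : ℝ) • y - z - x₀ = (2 : ℝ) • (y - ((1 / 2 : ℝ) • z + (1 / 2 : ℝ) • x₀)) := by
        module
      rw [this, norm_smul, Real.norm_eq_abs, abs_two]
      linarith
    have h := hf.logConcave.rpow_mul_rpow_le (t := 1 / 2) h0.le hm.le le_rfl (hball _ hw)
      (by norm_num) (by norm_num)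
    have hy' : (1 - 1 / 2 : ℝ) • z + (1 / 2 : ℝ) • ((2 : ℝ) • y - z) = y := by module
    rw [hy', show (1 - 1 / 2 : ℝ) = 1 / 2 by norm_num, ← Real.sqrt_eq_rpow, ← Real.sqrt_eq_rpow,
      ← Real.sqrt_mul h0.le] at h
    exact h
  have hmarkov := mul_meas_ge_le_integral_of_nonneg (ae_of_all _ hf.logConcave.1) hf.integrable
    (√(f z * m))
  have hmono : V ≤ volume.real {x | √(f z * m) ≤ f x} := by
    have : V = volume.real (Metric.closedBall ((1 / 2 : ℝ) • z + (1 / 2 : ℝ) • x₀) (r / 2)) := by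
      rw [hV, measureReal_def, measureReal_def,
        Measure.addHaar_closedBall_center volume ((1 / 2 : ℝ) • z + (1 / 2 : ℝ) • x₀)]
    rw [this]
    exact measureReal_mono hsub (hf.integrable.measure_ge_lt_top hs).ne
  have h1 : √(f z * m) ≤ (∫ x, f x) / V := by
    rw [le_div_iff₀ hVpos]
    exact (mul_le_mul_of_nonneg_left hmono hs.le).trans hmarkov
  rw [le_div_iff₀ hm, ← Real.sq_sqrt (mul_pos h0 hm).le]
  exact pow_le_pow_left₀ hs.le h1 2

theorem IsProperLogConcave.exists_tail_lt {d : ℕ} {f : EuclideanSpace ℝ (Fin d) → ℝ}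
    (hf : IsProperLogConcave f) {ε : ℝ≥0∞} (hε : 0 < ε) :
    ∃ R : ℝ, ∫⁻ x in {x | R ≤ ‖x‖}, ENNReal.ofReal (f x) < ε := by
  have hfin : IsFiniteMeasure (volume.withDensity fun x => ENNReal.ofReal (f x)) :=
    isFiniteMeasure_withDensity_ofReal hf.integrable.2
  have hmeas : ∀ n : ℕ, MeasurableSet {x : EuclideanSpace ℝ (Fin d) | (n : ℝ) ≤ ‖x‖} := fun n =>
    measurableSet_le measurable_const measurable_norm
  have hlim := tendsto_measure_iInter_atTop
    (μ := volume.withDensity fun x => ENNReal.ofReal (f x))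
    (s := fun n : ℕ => {x : EuclideanSpace ℝ (Fin d) | (n : ℝ) ≤ ‖x‖})
    (fun n => (hmeas n).nullMeasurableSet)
    (fun a b hab x (hx : (b : ℝ) ≤ ‖x‖) => (Nat.cast_le.2 hab).trans hx)
    ⟨0, measure_ne_top _ _⟩
  have hempty : ⋂ n : ℕ, {x : EuclideanSpace ℝ (Fin d) | (n : ℝ) ≤ ‖x‖} = ∅ := by
    ext x
    simp only [Set.mem_iInter, Set.mem_ofPred_eq, Set.mem_empty_iff_false, iff_false, not_forall,
      not_le]
    exact exists_nat_gt ‖x‖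
  rw [hempty, measure_empty] at hlim
  obtain ⟨n, hn⟩ := (hlim.eventually_lt_const hε).exists
  refine ⟨n, ?_⟩
  rwa [Function.comp_apply, withDensity_apply _ (hmeas n)] at hn

/-! ### Parameters dominated by a function and their compactness -/

namespace EllipsoidParam

/-- The copy of `φ` scaled by `P.α` and transported by `y ↦ A y + a` is below `f`. -/
def Dominated {d : ℕ} (P : EllipsoidParam d) (φ f : EuclideanSpace ℝ (Fin d) → ℝ) : Prop :=
  ∀ y, P.α * φ y ≤ f (Matrix.toEuclideanLin P.A y + P.a)

/-- The factor `α det A` by which the integral of a transported function is scaled. -/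
noncomputable def weight {d : ℕ} (P : EllipsoidParam d) : ℝ := P.α * P.A.det

theorem weight_pos {d : ℕ} (P : EllipsoidParam d) : 0 < P.weight :=
  mul_pos P.α_pos P.posDef.det_pos

theorem volume_image {d : ℕ} (P : EllipsoidParam d) (S : Set (EuclideanSpace ℝ (Fin d))) :
    volume ((fun y => Matrix.toEuclideanLin P.A y + P.a) '' S) =
      ENNReal.ofReal P.A.det * volume S := by
  have : (fun y => Matrix.toEuclideanLin P.A y + P.a) '' S =
      (fun x => x + P.a) '' (Matrix.toEuclideanLin P.A '' S) := by
    rw [Set.image_image]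
  rw [this, Set.image_add_right, measure_preimage_add_right, Measure.addHaar_image_linearMap,
    LinearMap.det_toLpLin, abs_of_pos P.posDef.det_pos]

/-- On the image of `S`, of volume `det A * volume S`, `f` is at least `α q`. Taking `T` to be the
whole space bounds the weight; taking a tail `{R ≤ ‖x‖}` bounds the position. -/
theorem Dominated.mul_volume_le {d : ℕ} {P : EllipsoidParam d}
    {φ f : EuclideanSpace ℝ (Fin d) → ℝ} (h : P.Dominated φ f) (hf : Measurable f)
    {S T : Set (EuclideanSpace ℝ (Fin d))} {q : ℝ} (hS : ∀ y ∈ S, q ≤ φ y)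
    (hST : ∀ y ∈ S, Matrix.toEuclideanLin P.A y + P.a ∈ T) :
    ENNReal.ofReal (q * P.weight) * volume S ≤ ∫⁻ x in T, ENNReal.ofReal (f x) := by
  have hsub : (fun y => Matrix.toEuclideanLin P.A y + P.a) '' S ⊆ T := by
    rintro _ ⟨y, hy, rfl⟩
    exact hST y hy
  refine le_trans ?_ (lintegral_mono_set hsub)
  have hconst : ∫⁻ _ in (fun y => Matrix.toEuclideanLin P.A y + P.a) '' S,
      ENNReal.ofReal (P.α * q) = ENNReal.ofReal (q * P.weight) * volume S := by
    rw [setLIntegral_const, P.volume_image, ← mul_assoc,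
      ← ENNReal.ofReal_mul' P.posDef.det_pos.le, weight]
    congr 2
    ring
  rw [← hconst]
  refine setLIntegral_mono hf.ennreal_ofReal ?_
  rintro _ ⟨y, hy, rfl⟩
  exact ENNReal.ofReal_le_ofReal ((mul_le_mul_of_nonneg_left (hS y hy) P.α_pos.le).trans (h y))

/-- Otherwise the ball of radius `1/4` about half the unit vector in direction `A u` is mapped into
`{R ≤ ⟪x, u⟫}`, since `⟪y, A u⟫ ≥ (1/2 - 1/4) ‖A u‖` there. This would put too much mass in the
tail. -/
theorem Dominated.inner_add_norm_lt {d : ℕ} {P : EllipsoidParam d}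
    {φ f : EuclideanSpace ℝ (Fin d) → ℝ} (h : P.Dominated φ f) (hf : Measurable f)
    {q c R : ℝ} (hq : 0 < q) (hφ : ∀ y, ‖y‖ ≤ 3 / 4 → q ≤ φ y) (hc : c ≤ P.weight)
    (hR : ∫⁻ x in {x | R ≤ ‖x‖}, ENNReal.ofReal (f x) <
      ENNReal.ofReal (q * c) * volume (Metric.closedBall (0 : EuclideanSpace ℝ (Fin d)) (1 / 4)))
    {u : EuclideanSpace ℝ (Fin d)} (hu : ‖u‖ = 1) :
    inner ℝ P.a u + ‖Matrix.toEuclideanLin P.A u‖ / 4 < R := by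
  by_contra! hcon
  set b := Matrix.toEuclideanLin P.A u with hb
  -- If `b = 0` this is `0`, and the argument still goes through.
  set w := ‖b‖⁻¹ • b with hw
  have hwn : ‖w‖ ≤ 1 := by
    rw [hw, norm_smul, norm_inv, norm_norm]
    exact inv_mul_le_one
  have hwb : inner ℝ w b = ‖b‖ := by
    rw [hw, real_inner_smul_left, real_inner_self_eq_norm_sq]
    rcases eq_or_ne ‖b‖ 0 with h0 | h0
    · simp [h0]
    · field_simp
  have hball : ∀ y ∈ Metric.closedBall ((1 / 2 : ℝ) • w) (1 / 4), ‖y‖ ≤ 3 / 4 := by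
    intro y hy
    rw [mem_closedBall_iff_norm] at hy
    have h1 : ‖(1 / 2 : ℝ) • w‖ ≤ 1 / 2 := by
      rw [norm_smul, Real.norm_eq_abs, abs_of_pos (by norm_num)]
      linarith
    have h2 := norm_add_le (y - (1 / 2 : ℝ) • w) ((1 / 2 : ℝ) • w)
    rw [sub_add_cancel] at h2
    linarith
  have hout : ∀ y ∈ Metric.closedBall ((1 / 2 : ℝ) • w) (1 / 4),
      Matrix.toEuclideanLin P.A y + P.a ∈ {x | R ≤ ‖x‖} := by
    intro y hy
    rw [mem_closedBall_iff_norm] at hy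
    have h1 : inner ℝ (Matrix.toEuclideanLin P.A y + P.a) u ≤
        ‖Matrix.toEuclideanLin P.A y + P.a‖ := by
      have := real_inner_le_norm (Matrix.toEuclideanLin P.A y + P.a) u
      rwa [hu, mul_one] at this
    rw [inner_add_left, inner_toEuclideanLin_comm P.posDef.1, ← hb] at h1
    have h2 : inner ℝ y b = (1 / 2) * ‖b‖ + inner ℝ (y - (1 / 2 : ℝ) • w) b := by
      rw [inner_sub_left, real_inner_smul_left, hwb]
      ring
    have h3 := neg_le_of_abs_le (abs_real_inner_le_norm (y - (1 / 2 : ℝ) • w) b)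
    have h4 : ‖y - (1 / 2 : ℝ) • w‖ * ‖b‖ ≤ 1 / 4 * ‖b‖ :=
      mul_le_mul_of_nonneg_right hy (norm_nonneg b)
    change R ≤ _
    linarith
  have := h.mul_volume_le hf (fun y hy => hφ y (hball y hy)) hout
  rw [Measure.addHaar_closedBall_center] at this
  refine absurd hR (not_lt.2 (le_trans ?_ this))
  gcongr

/-- The bound `K` depends on the profile only through `q`, so that it also serves a family of
profiles varying with `s`. -/
theorem exists_bound_of_dominated {d : ℕ} {f : EuclideanSpace ℝ (Fin d) → ℝ}
    (hf : IsProperLogConcave f) {q c : ℝ} (hq : 0 < q) (hc : 0 < c) :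
    ∃ K : ℝ, 0 ≤ K ∧ ∀ (φ : EuclideanSpace ℝ (Fin d) → ℝ) (P : EllipsoidParam d),
      (∀ y, ‖y‖ ≤ 3 / 4 → q ≤ φ y) → P.Dominated φ f → c ≤ P.weight →
        (∀ x, ‖Matrix.toEuclideanLin P.A x‖ ≤ K * ‖x‖) ∧ |P.α| ≤ K ∧ ‖P.a‖ ≤ K := by
  obtain ⟨C, hC, hfC⟩ := hf.exists_bound
  have hε : 0 < ENNReal.ofReal (q * c) *
      volume (Metric.closedBall (0 : EuclideanSpace ℝ (Fin d)) (1 / 4)) :=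
    ENNReal.mul_pos (ENNReal.ofReal_pos.2 (mul_pos hq hc)).ne'
      (Metric.measure_closedBall_pos _ _ (by norm_num)).ne'
  obtain ⟨R, hR⟩ := hf.exists_tail_lt hε
  refine ⟨4 * |R| + C / q, by positivity, fun φ P hφ hP hw => ?_⟩
  have hCq : 0 < C / q := div_pos hC hq
  have key : ∀ u : EuclideanSpace ℝ (Fin d), ‖u‖ = 1 →
      inner ℝ P.a u ≤ |R| ∧ ‖Matrix.toEuclideanLin P.A u‖ ≤ 4 * |R| := by
    intro u hu
    -- Adding the estimates for `u` and `-u` cancels the centre and leaves `‖A u‖ < 4 R`.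
    have h1 := hP.inner_add_norm_lt hf.usc.measurable hq hφ hw hR hu
    have h2 := hP.inner_add_norm_lt hf.usc.measurable hq hφ hw hR (u := -u) (by rwa [norm_neg])
    rw [inner_neg_right, map_neg, norm_neg] at h2
    have h3 := norm_nonneg (Matrix.toEuclideanLin P.A u)
    have h4 := le_abs_self R
    constructor <;> linarith
  refine ⟨fun x => ?_, ?_, ?_⟩
  · rcases eq_or_ne x 0 with rfl | hx
    · simp
    have hx' : 0 < ‖x‖ := norm_pos_iff.2 hx
    have h := (key (‖x‖⁻¹ • x) (by rw [norm_smul, norm_inv, norm_norm]; field_simp)).2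
    rw [map_smul, norm_smul, norm_inv, norm_norm, inv_mul_le_iff₀ hx'] at h
    nlinarith
  · have h1 := (mul_le_mul_of_nonneg_left (hφ 0 (by rw [norm_zero]; norm_num)) P.α_pos.le).trans
      ((hP 0).trans (hfC _))
    rw [abs_of_pos P.α_pos]
    have h2 : P.α ≤ C / q := by rwa [le_div_iff₀ hq]
    have := abs_nonneg R
    linarith
  · rcases eq_or_ne P.a 0 with h0 | h0
    · rw [h0, norm_zero]; positivity
    have ha : 0 < ‖P.a‖ := norm_pos_iff.2 h0
    have h := (key (‖P.a‖⁻¹ • P.a) (by rw [norm_smul, norm_inv, norm_norm]; field_simp)).1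
    rw [real_inner_smul_right, real_inner_self_eq_norm_sq, sq, inv_mul_cancel_left₀ ha.ne'] at h
    have := abs_nonneg R
    linarith

end EllipsoidParam

/-! ### Passing to limits of parameters -/

theorem tendsto_toEuclideanLin_apply {d : ℕ} {ι : Type*} {l : Filter ι}
    {A : ι → Matrix (Fin d) (Fin d) ℝ} {A₀ : Matrix (Fin d) (Fin d) ℝ}
    {x : ι → EuclideanSpace ℝ (Fin d)} {x₀ : EuclideanSpace ℝ (Fin d)}
    (hA : Tendsto A l (𝓝 A₀)) (hx : Tendsto x l (𝓝 x₀)) :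
    Tendsto (fun i => Matrix.toEuclideanLin (A i) (x i)) l (𝓝 (Matrix.toEuclideanLin A₀ x₀)) := by
  have h1 : Tendsto (fun i => WithLp.ofLp (x i)) l (𝓝 (WithLp.ofLp x₀)) :=
    ((PiLp.continuous_ofLp 2 fun _ : Fin d => ℝ).tendsto x₀).comp hx
  have h2 : Continuous fun p : Matrix (Fin d) (Fin d) ℝ × (Fin d → ℝ) => p.1.mulVec p.2 :=
    continuous_fst.matrix_mulVec continuous_snd
  have h3 : Tendsto (fun i => (A i).mulVec (WithLp.ofLp (x i))) l
      (𝓝 (A₀.mulVec (WithLp.ofLp x₀))) :=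
    (h2.tendsto (A₀, WithLp.ofLp x₀)).comp (hA.prodMk_nhds h1)
  exact ((PiLp.continuous_toLp 2 fun _ : Fin d => ℝ).tendsto _).comp h3

theorem posSemidef_of_tendsto {d : ℕ} {ι : Type*} {l : Filter ι} [l.NeBot]
    {A : ι → Matrix (Fin d) (Fin d) ℝ} {A₀ : Matrix (Fin d) (Fin d) ℝ}
    (hA : Tendsto A l (𝓝 A₀)) (hpos : ∀ i, (A i).PosDef) : A₀.PosSemidef := by
  refine Matrix.PosSemidef.of_dotProduct_mulVec_nonneg ?_ fun x => ?_
  · have h1 : Tendsto (fun i => (A i).conjTranspose) l (𝓝 A₀.conjTranspose) :=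
      (continuous_id.matrix_conjTranspose.tendsto A₀).comp hA
    have h2 : (fun i => (A i).conjTranspose) = A := funext fun i => (hpos i).1
    rw [h2] at h1
    exact tendsto_nhds_unique h1 hA
  · have h : Continuous fun M : Matrix (Fin d) (Fin d) ℝ => star x ⬝ᵥ (M.mulVec x) := by fun_prop
    exact ge_of_tendsto' ((h.tendsto A₀).comp hA) fun i =>
      (hpos i).posSemidef.dotProduct_mulVec_nonneg x

theorem UpperSemicontinuous.le_of_tendsto {X ι : Type*} [TopologicalSpace X] {f : X → ℝ}
    (hf : UpperSemicontinuous f) {l : Filter ι} [l.NeBot] {x : ι → X} {x₀ : X} {b : ι → ℝ} {b₀ : ℝ}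
    (hx : Tendsto x l (𝓝 x₀)) (hb : Tendsto b l (𝓝 b₀)) (h : ∀ i, b i ≤ f (x i)) : b₀ ≤ f x₀ := by
  by_contra! hlt
  obtain ⟨c, hc1, hc2⟩ := exists_between hlt
  obtain ⟨i, hi1, hi2⟩ := ((hx.eventually (hf x₀ c hc1)).and (hb.eventually_const_lt hc2)).exists
  exact absurd (h i) (not_le.2 (hi1.trans hi2))

-- In the operator norm the hypothesis bounds the triples in a finite-dimensional space. The limit
-- is stated as a bare triple because it may be degenerate.
open scoped Matrix.Norms.L2Operator in
theorem exists_subseq_tendsto_of_bounded {d : ℕ} {P : ℕ → EllipsoidParam d} {K : ℝ}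
    (hK : 0 ≤ K) (h : ∀ k, (∀ x, ‖Matrix.toEuclideanLin (P k).A x‖ ≤ K * ‖x‖) ∧ |(P k).α| ≤ K ∧
      ‖(P k).a‖ ≤ K) :
    ∃ (A : Matrix (Fin d) (Fin d) ℝ) (α : ℝ) (a : EuclideanSpace ℝ (Fin d)) (σ : ℕ → ℕ),
      StrictMono σ ∧ Tendsto (fun k => (P (σ k)).A) atTop (𝓝 A) ∧
      Tendsto (fun k => (P (σ k)).α) atTop (𝓝 α) ∧
      Tendsto (fun k => (P (σ k)).a) atTop (𝓝 a) := by
  have hA : ∀ k, ‖(P k).A‖ ≤ K := fun k => by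
    rw [Matrix.cstar_norm_def]
    exact ContinuousLinearMap.opNorm_le_bound _ hK (h k).1
  obtain ⟨⟨A, α, a⟩, -, σ, hσ, hlim⟩ := tendsto_subseq_of_bounded
    (s := Metric.closedBall (0 : Matrix (Fin d) (Fin d) ℝ × ℝ × EuclideanSpace ℝ (Fin d)) K)
    Metric.isBounded_closedBall (x := fun k => ((P k).A, (P k).α, (P k).a)) fun k => by
      rw [mem_closedBall_zero_iff, Prod.norm_def, Prod.norm_def]
      exact max_le (hA k) (max_le (h k).2.1 (h k).2.2)
  rw [Prod.tendsto_iff, Prod.tendsto_iff] at hlim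
  exact ⟨A, α, a, σ, hσ, hlim.1, hlim.2.1, hlim.2.2⟩

namespace EllipsoidParam

/-- Dominated parameters of weight bounded below subconverge to dominated parameters. -/
theorem exists_subseq_tendsto {d : ℕ} {f : EuclideanSpace ℝ (Fin d) → ℝ}
    (hf : IsProperLogConcave f) {φ : ℕ → EuclideanSpace ℝ (Fin d) → ℝ}
    {φ₀ : EuclideanSpace ℝ (Fin d) → ℝ} {q c : ℝ} (hq : 0 < q) (hc : 0 < c)
    (hφ : ∀ k y, ‖y‖ ≤ 3 / 4 → q ≤ φ k y)
    (hlim : ∀ y, Tendsto (fun k => φ k y) atTop (𝓝 (φ₀ y))) {P : ℕ → EllipsoidParam d}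
    (hP : ∀ k, (P k).Dominated (φ k) f) (hw : ∀ k, c ≤ (P k).weight) :
    ∃ (Q : EllipsoidParam d) (σ : ℕ → ℕ), StrictMono σ ∧
      Tendsto (fun k => (P (σ k)).A) atTop (𝓝 Q.A) ∧
      Tendsto (fun k => (P (σ k)).α) atTop (𝓝 Q.α) ∧
      Tendsto (fun k => (P (σ k)).a) atTop (𝓝 Q.a) ∧
      Tendsto (fun k => (P (σ k)).weight) atTop (𝓝 Q.weight) ∧ Q.Dominated φ₀ f := by
  obtain ⟨K, hK, hbound⟩ := exists_bound_of_dominated hf hq hc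
  obtain ⟨A, α, a, σ, hσ, hA, hα, ha⟩ := exists_subseq_tendsto_of_bounded hK fun k =>
    hbound (φ k) (P k) (hφ k) (hP k) (hw k)
  have hdet : Tendsto (fun k => (P (σ k)).A.det) atTop (𝓝 A.det) :=
    (continuous_id.matrix_det.tendsto A).comp hA
  have hweight := hα.mul hdet
  have hcw : c ≤ α * A.det := ge_of_tendsto' hweight fun k => hw (σ k)
  have hα0 : 0 ≤ α := ge_of_tendsto' hα fun k => (P (σ k)).α_pos.le
  have hpsd : A.PosSemidef := posSemidef_of_tendsto hA fun k => (P (σ k)).posDef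
  -- The bound `0 < c ≤ α det A` survives in the limit and excludes degeneration of both `A` and
  -- `α`.
  have hdet0 : A.det ≠ 0 := fun h0 => by rw [h0, mul_zero] at hcw; linarith
  have hαpos : 0 < α := hα0.lt_of_ne fun h0 => by rw [← h0, zero_mul] at hcw; linarith
  refine ⟨⟨A, α, a, hpsd.posDef_iff_det_ne_zero.2 hdet0, hαpos⟩, σ, hσ, hA, hα, ha, hweight,
    fun y => ?_⟩
  exact hf.usc.le_of_tendsto ((tendsto_toEuclideanLin_apply hA tendsto_const_nhds).add ha)
    (hα.mul ((hlim y).comp hσ.tendsto_atTop)) fun k => hP (σ k) y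

end EllipsoidParam

/-! ### Existence and uniqueness of maximal dominated parameters -/

namespace EllipsoidParam

/-- `P` has maximal weight among the parameters whose transport of `φ` is below `f`. -/
def IsMaximalDominated {d : ℕ} (P : EllipsoidParam d) (φ f : EuclideanSpace ℝ (Fin d) → ℝ) :
    Prop :=
  P.Dominated φ f ∧ ∀ Q : EllipsoidParam d, Q.Dominated φ f → Q.weight ≤ P.weight

theorem exists_isMaximalDominated {d : ℕ} {φ f : EuclideanSpace ℝ (Fin d) → ℝ}
    (hf : IsProperLogConcave f) {q : ℝ} (hq : 0 < q) (hφ : ∀ y, ‖y‖ ≤ 3 / 4 → q ≤ φ y)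
    {P₀ : EllipsoidParam d} (hP₀ : P₀.Dominated φ f) :
    ∃ P : EllipsoidParam d, P.IsMaximalDominated φ f := by
  set W : Set ℝ := {w | ∃ P : EllipsoidParam d, P.Dominated φ f ∧ P.weight = w} with hW
  set V := volume.real (Metric.closedBall (0 : EuclideanSpace ℝ (Fin d)) (3 / 4)) with hV
  have hVpos : 0 < V :=
    ENNReal.toReal_pos (Metric.measure_closedBall_pos _ _ (by norm_num)).ne'
      measure_closedBall_lt_top.ne
  have hbdd : BddAbove W := by
    refine ⟨(∫ x, f x) / V / q, ?_⟩
    rintro w ⟨P, hP, rfl⟩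
    have h := hP.mul_volume_le hf.usc.measurable (S := Metric.closedBall 0 (3 / 4))
      (T := Set.univ) (fun y hy => hφ y (mem_closedBall_zero_iff.1 hy)) fun _ _ => Set.mem_univ _
    rw [Measure.restrict_univ, ← ofReal_integral_eq_lintegral_ofReal hf.integrable
      (ae_of_all _ hf.logConcave.1)] at h
    have h2 := ENNReal.toReal_mono ENNReal.ofReal_ne_top h
    rw [ENNReal.toReal_mul, ENNReal.toReal_ofReal (mul_pos hq P.weight_pos).le,
      ENNReal.toReal_ofReal hf.integral_pos.le] at h2
    rw [le_div_iff₀ hq, le_div_iff₀ hVpos, mul_comm P.weight]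
    exact h2
  obtain ⟨u, hmono, hlim, hmem⟩ := exists_seq_tendsto_sSup (S := W) ⟨_, P₀, hP₀, rfl⟩ hbdd
  choose P hP hPw using hmem
  -- The maximising sequence is monotone, so the weight of its first term is the lower bound that
  -- compactness requires.
  obtain ⟨Q, σ, hσ, -, -, -, hw, hQ⟩ := exists_subseq_tendsto hf (φ := fun _ => φ) hq
    (P 0).weight_pos (fun _ => hφ) (fun _ => tendsto_const_nhds) hP fun k => by
      rw [hPw, hPw]
      exact hmono (Nat.zero_le k)
  refine ⟨Q, hQ, fun R hR => ?_⟩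
  have h1 : Tendsto (fun k => (P (σ k)).weight) atTop (𝓝 (sSup W)) := by
    simp only [hPw]
    exact hlim.comp hσ.tendsto_atTop
  rw [tendsto_nhds_unique hw h1]
  exact le_csSup hbdd ⟨R, hR, rfl⟩

/-! ### Averaging and uniqueness -/

/-- The midpoint of two parameters, with the geometric mean of the heights. -/
noncomputable def midpoint {d : ℕ} (P Q : EllipsoidParam d) : EllipsoidParam d where
  A := (1 / 2 : ℝ) • (P.A + Q.A)
  α := √(P.α * Q.α)
  a := (1 / 2 : ℝ) • (P.a + Q.a)
  posDef := (P.posDef.add Q.posDef).smul (by norm_num)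
  α_pos := Real.sqrt_pos.2 (mul_pos P.α_pos Q.α_pos)

/-- Both copies are compared at the same `y`, and `√(α φ(y) · α' φ(y)) = √(α α') φ(y)`; this is why
heights are averaged geometrically. -/
theorem Dominated.midpoint {d : ℕ} {P Q : EllipsoidParam d}
    {φ f : EuclideanSpace ℝ (Fin d) → ℝ} (hf : IsLogConcave f) (hφ : ∀ y, 0 ≤ φ y)
    (hP : P.Dominated φ f) (hQ : Q.Dominated φ f) : (P.midpoint Q).Dominated φ f := by
  intro y
  have h := hf.rpow_mul_rpow_le (t := 1 / 2) (mul_nonneg P.α_pos.le (hφ y))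
    (mul_nonneg Q.α_pos.le (hφ y)) (hP y) (hQ y) (by norm_num) (by norm_num)
  have h1 : (1 - 1 / 2 : ℝ) = 1 / 2 := by norm_num
  rw [h1, ← Real.sqrt_eq_rpow, ← Real.sqrt_eq_rpow,
    ← Real.sqrt_mul (mul_nonneg P.α_pos.le (hφ y)),
    show P.α * φ y * (Q.α * φ y) = P.α * Q.α * φ y ^ 2 by ring,
    Real.sqrt_mul (mul_pos P.α_pos Q.α_pos).le, Real.sqrt_sq (hφ y)] at h
  have h2 : Matrix.toEuclideanLin (P.midpoint Q).A y + (P.midpoint Q).a =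
      (1 / 2 : ℝ) • (Matrix.toEuclideanLin P.A y + P.a) +
      (1 / 2 : ℝ) • (Matrix.toEuclideanLin Q.A y + Q.a) := by
    simp only [EllipsoidParam.midpoint, map_smul, map_add, LinearMap.smul_apply,
      LinearMap.add_apply]
    module
  rw [h2]
  exact h

/-- The squared weight of the midpoint is `α α' det((A + A')/2)²`, at least `α α' det A det A'`, the
square of the common maximal weight. Maximality forces equality in the determinant inequality. -/
theorem IsMaximalDominated.A_eq_and_α_eq {d : ℕ} {P Q : EllipsoidParam d}
    {φ f : EuclideanSpace ℝ (Fin d) → ℝ} (hf : IsLogConcave f) (hφ : ∀ y, 0 ≤ φ y)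
    (hP : P.IsMaximalDominated φ f) (hQ : Q.IsMaximalDominated φ f) : P.A = Q.A ∧ P.α = Q.α := by
  have hw : P.weight = Q.weight := le_antisymm (hQ.2 P hP.1) (hP.2 Q hQ.1)
  obtain ⟨hle, heq⟩ := P.posDef.det_midpoint Q.posDef
  have hmid : (P.midpoint Q).weight ≤ P.weight := hP.2 _ (hP.1.midpoint hf hφ hQ.1)
  have hαα : 0 < P.α * Q.α := mul_pos P.α_pos Q.α_pos
  have h1 : (P.midpoint Q).weight ^ 2 =
      P.α * Q.α * ((1 / 2 : ℝ) • (P.A + Q.A)).det ^ 2 := by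
    simp only [weight, EllipsoidParam.midpoint, mul_pow, Real.sq_sqrt hαα.le]
  have h2 : P.weight ^ 2 = P.α * Q.α * (P.A.det * Q.A.det) := by
    rw [sq]
    nth_rw 2 [hw]
    simp only [weight]
    ring
  have h3 : (P.midpoint Q).weight ^ 2 ≤ P.weight ^ 2 :=
    pow_le_pow_left₀ (weight_pos _).le hmid 2
  rw [h1, h2] at h3
  have hA : P.A = Q.A := heq (le_antisymm hle (le_of_mul_le_mul_left h3 hαα))
  refine ⟨hA, ?_⟩
  rw [weight, weight, ← hA] at hw
  exact mul_right_cancel₀ P.posDef.det_pos.ne' hw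

/-- With `A` and `α` common, `f` is at least `α φ(y)` on the whole segment from `A y + P.a` to `A y
+ Q.a`. Adding `ε v vᵀ` to `A`, with `v = Q.a - P.a` and the centre at the midpoint, moves the image
of `y` along this segment and increases the determinant. Bounded support is what lets one `ε` work
for all relevant `y`. -/
theorem IsMaximalDominated.eq {d : ℕ} {P Q : EllipsoidParam d}
    {φ f : EuclideanSpace ℝ (Fin d) → ℝ} (hf : IsLogConcave f) (hφ : ∀ y, 0 ≤ φ y)
    (hsupp : ∀ y, 1 < ‖y‖ → φ y = 0) (hP : P.IsMaximalDominated φ f)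
    (hQ : Q.IsMaximalDominated φ f) : P = Q := by
  obtain ⟨hA, hα⟩ := hP.A_eq_and_α_eq hf hφ hQ
  suffices ha : P.a = Q.a by
    cases P
    cases Q
    simp_all
  by_contra hne
  set v := Q.a - P.a with hv
  have hv0 : v ≠ 0 := sub_ne_zero.2 (Ne.symm hne)
  have hvn : 0 < ‖v‖ := norm_pos_iff.2 hv0
  have hv0' : WithLp.ofLp v ≠ 0 := fun h => hv0 (by ext i; simp [h])
  -- This `ε` gives `|ε ⟪v, y⟫| ≤ 1/2` on the unit ball, so the position `1/2 + ε ⟪v, y⟫` on the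
  -- segment stays in `[0, 1]`.
  have hε : 0 < 1 / (2 * ‖v‖) := by positivity
  set ε := 1 / (2 * ‖v‖) with hεdef
  let R : EllipsoidParam d := ⟨P.A + Matrix.vecMulVec (ε • WithLp.ofLp v) (WithLp.ofLp v), P.α,
    (1 / 2 : ℝ) • (P.a + Q.a), posDef_add_vecMulVec P.posDef _ hε, P.α_pos⟩
  have hR : R.Dominated φ f := by
    intro y
    rcases lt_or_ge 1 ‖y‖ with hy | hy
    · rw [hsupp y hy, mul_zero]
      exact hf.1 _
    have hin : |ε * inner ℝ v y| ≤ 1 / 2 := by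
      rw [abs_mul, abs_of_pos hε]
      have h1 := abs_real_inner_le_norm v y
      have h2 : ‖v‖ * ‖y‖ ≤ ‖v‖ := mul_le_of_le_one_right hvn.le hy
      calc ε * |inner ℝ v y| ≤ ε * ‖v‖ := mul_le_mul_of_nonneg_left (h1.trans h2) hε.le
        _ = 1 / 2 := by rw [hεdef]; field_simp
    obtain ⟨hin1, hin2⟩ := abs_le.1 hin
    have hQy := hQ.1 y
    rw [← hA, ← hα] at hQy
    have h := hf.le_of_le (t := 1 / 2 + ε * inner ℝ v y) (hP.1 y) hQy (by linarith) (by linarith)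
    have hrank : Matrix.toEuclideanLin
        (Matrix.vecMulVec (ε • WithLp.ofLp v) (WithLp.ofLp v)) y = (ε * inner ℝ v y) • v := by
      ext i
      simp only [Matrix.toLpLin_apply, Matrix.vecMulVec_mulVec, PiLp.inner_apply, PiLp.smul_apply]
      simp only [dotProduct, Pi.smul_apply, smul_eq_mul, MulOpposite.smul_eq_mul_unop,
        MulOpposite.unop_op, RCLike.inner_apply, conj_trivial, mul_comm]
      ring
    have heq : Matrix.toEuclideanLin R.A y + R.a =
        (1 - (1 / 2 + ε * inner ℝ v y)) • (Matrix.toEuclideanLin P.A y + P.a) +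
          (1 / 2 + ε * inner ℝ v y) • (Matrix.toEuclideanLin P.A y + Q.a) := by
      simp only [R, map_add, LinearMap.add_apply]
      rw [hrank, hv]
      module
    rw [heq]
    exact h
  have hlt : P.weight < R.weight :=
    mul_lt_mul_of_pos_left (det_lt_det_add_vecMulVec P.posDef hv0' hε) P.α_pos
  exact absurd (hP.2 R hR) (not_le.2 hlt)

theorem weight_lintegral {d : ℕ} (P : EllipsoidParam d) {φ : EuclideanSpace ℝ (Fin d) → ℝ}
    (hφ : Measurable φ) :
    ∫⁻ x, ENNReal.ofReal (P.α * φ (Matrix.toEuclideanLin P.A⁻¹ (x - P.a))) =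
      ENNReal.ofReal P.weight * ∫⁻ y, ENNReal.ofReal (φ y) := by
  have hdet : LinearMap.det (Matrix.toEuclideanLin P.A⁻¹) = P.A.det⁻¹ := by
    rw [LinearMap.det_toLpLin, Matrix.det_nonsing_inv, Ring.inverse_eq_inv']
  have hdet0 : LinearMap.det (Matrix.toEuclideanLin P.A⁻¹) ≠ 0 := by
    rw [hdet]; exact inv_ne_zero P.posDef.det_pos.ne'
  have hmeas : Measurable fun y => ENNReal.ofReal (P.α * φ y) :=
    (hφ.const_mul _).ennreal_ofReal
  have hL : Measurable (Matrix.toEuclideanLin P.A⁻¹) :=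
    (LinearMap.continuous_of_finiteDimensional _).measurable
  rw [lintegral_sub_right_eq_self
      (fun x => ENNReal.ofReal (P.α * φ (Matrix.toEuclideanLin P.A⁻¹ x))) P.a,
    ← lintegral_map (μ := volume) hmeas hL,
    Measure.map_linearMap_addHaar_eq_smul_addHaar _ hdet0, lintegral_smul_measure, hdet, inv_inv,
    abs_of_pos P.posDef.det_pos]
  simp_rw [ENNReal.ofReal_mul P.α_pos.le]
  rw [lintegral_const_mul _ hφ.ennreal_ofReal, weight, ENNReal.ofReal_mul P.α_pos.le, smul_eq_mul]
  ring

end EllipsoidParam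

/-! ### Lifted and Gaussian profiles -/

/-- The `s`-marginal density of the unit ball of `ℝᵈ × ℝ`. -/
noncomputable def liftProfile {d : ℕ} (s : ℝ) (y : EuclideanSpace ℝ (Fin d)) : ℝ :=
  √(1 - ‖y‖ ^ 2) ^ s

/-- The `s`-marginal density of the unit ball, rescaled to converge to a Gaussian. -/
noncomputable def rescaledProfile {d : ℕ} (s : ℝ) (y : EuclideanSpace ℝ (Fin d)) : ℝ :=
  liftProfile s (√(2 / s) • y)

/-- The standard Gaussian profile. -/
noncomputable def gaussianProfile {d : ℕ} (y : EuclideanSpace ℝ (Fin d)) : ℝ :=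
  Real.exp (-‖y‖ ^ 2)

theorem liftProfile_nonneg {d : ℕ} (s : ℝ) (y : EuclideanSpace ℝ (Fin d)) :
    0 ≤ liftProfile s y :=
  Real.rpow_nonneg (Real.sqrt_nonneg _) _

theorem liftProfile_eq_zero {d : ℕ} {s : ℝ} (hs : 0 < s) {y : EuclideanSpace ℝ (Fin d)}
    (hy : 1 < ‖y‖) : liftProfile s y = 0 := by
  rw [liftProfile, Real.sqrt_eq_zero_of_nonpos (by nlinarith), Real.zero_rpow hs.ne']

theorem liftProfile_le_one {d : ℕ} {s : ℝ} (hs : 0 < s) (y : EuclideanSpace ℝ (Fin d)) :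
    liftProfile s y ≤ 1 :=
  Real.rpow_le_one (Real.sqrt_nonneg _) (Real.sqrt_le_one.2 (by nlinarith [sq_nonneg ‖y‖])) hs.le

/-- On this ball `1 - ‖y‖² ≥ 7/16 ≥ (1/2)²`. The bound degenerates as `s → ∞`, so it serves only for
fixed `s`. -/
theorem le_liftProfile {d : ℕ} {s : ℝ} (hs : 0 < s) {y : EuclideanSpace ℝ (Fin d)}
    (hy : ‖y‖ ≤ 3 / 4) : (1 / 2 : ℝ) ^ s ≤ liftProfile s y := by
  refine Real.rpow_le_rpow (by norm_num) (Real.le_sqrt_of_sq_le ?_) hs.le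
  nlinarith [norm_nonneg y]

theorem measurable_liftProfile {d : ℕ} (s : ℝ) :
    Measurable (liftProfile s : EuclideanSpace ℝ (Fin d) → ℝ) := by
  unfold liftProfile
  fun_prop

theorem measurable_rescaledProfile {d : ℕ} (s : ℝ) :
    Measurable (rescaledProfile s : EuclideanSpace ℝ (Fin d) → ℝ) :=
  (measurable_liftProfile s).comp (measurable_const_smul _)

theorem measurable_gaussianProfile {d : ℕ} :
    Measurable (gaussianProfile : EuclideanSpace ℝ (Fin d) → ℝ) := by
  unfold gaussianProfile
  fun_prop

theorem rescaledProfile_eq {d : ℕ} {s : ℝ} (hs : 0 < s) (y : EuclideanSpace ℝ (Fin d)) :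
    rescaledProfile s y = √(1 - ‖y‖ ^ 2 / (s / 2)) ^ s := by
  rw [rescaledProfile, liftProfile, norm_smul, Real.norm_of_nonneg (Real.sqrt_nonneg _), mul_pow,
    Real.sq_sqrt (by positivity)]
  congr 3
  field_simp

theorem one_sub_div_rpow_le_exp {u p : ℝ} (hp : 0 < p) (hu : u ≤ p) :
    (1 - u / p) ^ p ≤ Real.exp (-u) := by
  have h1 : 0 ≤ 1 - u / p := by rw [sub_nonneg, div_le_one hp]; exact hu
  have h2 : 1 - u / p ≤ Real.exp (-(u / p)) := by
    have := Real.add_one_le_exp (-(u / p)); linarith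
  calc (1 - u / p) ^ p ≤ Real.exp (-(u / p)) ^ p := Real.rpow_le_rpow h1 h2 hp.le
    _ = Real.exp (-u) := by rw [← Real.exp_mul]; congr 1; field_simp

theorem sq_mul_exp_neg_le {u : ℝ} (hu : 0 ≤ u) : u ^ 2 * Real.exp (-u) ≤ 2 := by
  rw [Real.exp_neg, ← div_eq_mul_inv, div_le_iff₀ (Real.exp_pos u)]
  have := Real.quadratic_le_exp_of_nonneg hu
  nlinarith

/-- With `x = u / p`, raise `eˣ (1 - x) ≥ 1 - x²` to the power `p` and apply Bernoulli: `(1 - x)ᵖ ≥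
e⁻ᵘ (1 - u²/p)`. Then use `u² e⁻ᵘ ≤ 2`. -/
theorem exp_neg_sub_le {u p : ℝ} (hp : 1 ≤ p) (hu0 : 0 ≤ u) (hu : u ≤ p) :
    Real.exp (-u) - (1 - u / p) ^ p ≤ 2 / p := by
  have hp0 : 0 < p := by linarith
  set x := u / p with hx
  have hx0 : 0 ≤ x := by positivity
  have hx1 : x ≤ 1 := (div_le_one hp0).2 hu
  have hxp : x * p = u := by rw [hx]; field_simp
  have hbern := one_add_mul_self_le_rpow_one_add (s := -x ^ 2) (by nlinarith) hp
  have h1 : (1 + -x ^ 2) ^ p ≤ (Real.exp x * (1 - x)) ^ p := by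
    refine Real.rpow_le_rpow (by nlinarith) ?_ hp0.le
    have := mul_le_mul_of_nonneg_right (Real.add_one_le_exp x) (sub_nonneg.2 hx1)
    linarith
  rw [Real.mul_rpow (Real.exp_pos x).le (sub_nonneg.2 hx1), ← Real.exp_mul, hxp] at h1
  have h2 : Real.exp (-u) * (1 + p * -x ^ 2) ≤ (1 - x) ^ p := by
    have := mul_le_mul_of_nonneg_left (hbern.trans h1) (Real.exp_pos (-u)).le
    rwa [← mul_assoc, ← Real.exp_add, neg_add_cancel, Real.exp_zero, one_mul] at this
  have h3 : Real.exp (-u) * (p * x ^ 2) = u ^ 2 * Real.exp (-u) / p := by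
    rw [← hxp]; field_simp
  have h4 : u ^ 2 * Real.exp (-u) / p ≤ 2 / p :=
    div_le_div_of_nonneg_right (sq_mul_exp_neg_le hu0) hp0.le
  linarith

theorem rescaledProfile_le_gaussianProfile {d : ℕ} {s : ℝ} (hs : 0 < s)
    (y : EuclideanSpace ℝ (Fin d)) : rescaledProfile s y ≤ gaussianProfile y := by
  rw [rescaledProfile_eq hs, gaussianProfile]
  rcases le_total (‖y‖ ^ 2) (s / 2) with h | h
  · rw [Real.sqrt_eq_rpow, ← Real.rpow_mul (sub_nonneg.2 ((div_le_one (by positivity)).2 h)),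
      show 1 / 2 * s = s / 2 by ring]
    exact one_sub_div_rpow_le_exp (by positivity) h
  · rw [Real.sqrt_eq_zero_of_nonpos (sub_nonpos.2 ((one_le_div (by positivity)).2 h)),
      Real.zero_rpow hs.ne']
    positivity

theorem gaussianProfile_sub_rescaledProfile_le {d : ℕ} {s : ℝ} (hs : 2 ≤ s)
    (y : EuclideanSpace ℝ (Fin d)) : gaussianProfile y - rescaledProfile s y ≤ 4 / s := by
  have hs0 : 0 < s := by linarith
  have h4 : 4 / s = 2 / (s / 2) := by field_simp; norm_num
  rw [rescaledProfile_eq hs0, gaussianProfile, h4]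
  rcases le_total (‖y‖ ^ 2) (s / 2) with h | h
  · rw [Real.sqrt_eq_rpow, ← Real.rpow_mul (sub_nonneg.2 ((div_le_one (by positivity)).2 h)),
      show 1 / 2 * s = s / 2 by ring]
    exact exp_neg_sub_le (by linarith) (by positivity) h
  · rw [Real.sqrt_eq_zero_of_nonpos (sub_nonpos.2 ((one_le_div (by positivity)).2 h)),
      Real.zero_rpow hs0.ne', sub_zero, le_div_iff₀ (by positivity), mul_comm]
    -- Off the support `‖y‖² ≥ s/2 ≥ 1`, hence `s/2 ≤ (‖y‖²)²`.
    refine le_trans ?_ (sq_mul_exp_neg_le (sq_nonneg ‖y‖))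
    refine mul_le_mul_of_nonneg_right ?_ (Real.exp_pos _).le
    nlinarith

theorem abs_rescaledProfile_sub_le {d : ℕ} {s : ℝ} (hs : 2 ≤ s)
    (y : EuclideanSpace ℝ (Fin d)) : |rescaledProfile s y - gaussianProfile y| ≤ 4 / s := by
  have h1 := rescaledProfile_le_gaussianProfile (by linarith) y (s := s)
  have h2 := gaussianProfile_sub_rescaledProfile_le hs y
  rw [abs_of_nonpos (by linarith)]
  linarith

theorem tendsto_rescaledProfile {d : ℕ} (y : EuclideanSpace ℝ (Fin d)) :
    Tendsto (fun s : ℝ => rescaledProfile s y) atTop (𝓝 (gaussianProfile y)) := by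
  rw [tendsto_iff_dist_tendsto_zero]
  refine squeeze_zero' (Eventually.of_forall fun _ => dist_nonneg) ?_
    (tendsto_const_nhds.div_atTop tendsto_id : Tendsto (fun s : ℝ => 4 / s) atTop (𝓝 0))
  filter_upwards [eventually_ge_atTop 2] with s hs
  exact abs_rescaledProfile_sub_le hs y

/-- The lower bound uniform in `s` that compactness needs as `s → ∞`. The value `40` makes the error
`4 / s` at most `1/10`, while the Gaussian profile is at least `1/4` on this ball. -/
theorem le_rescaledProfile {d : ℕ} {s : ℝ} (hs : 40 ≤ s) {y : EuclideanSpace ℝ (Fin d)}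
    (hy : ‖y‖ ≤ 3 / 4) : 1 / 10 ≤ rescaledProfile s y := by
  have h1 := gaussianProfile_sub_rescaledProfile_le (by linarith : (2 : ℝ) ≤ s) y
  have h2 : 4 / s ≤ 1 / 10 := by
    rw [div_le_div_iff₀ (by linarith) (by norm_num)]; linarith
  have h3 : 1 / 4 ≤ gaussianProfile y := by
    rw [gaussianProfile]
    have := Real.add_one_le_exp (-‖y‖ ^ 2)
    nlinarith [norm_nonneg y]
  linarith

theorem lintegral_gaussianProfile_lt_top {d : ℕ} :
    ∫⁻ y : EuclideanSpace ℝ (Fin d), ENNReal.ofReal (gaussianProfile y) < ∞ := by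
  have h := GaussianFourier.integrable_cexp_neg_mul_sq_norm_add (V := EuclideanSpace ℝ (Fin d))
    (b := 1) (by norm_num) 0 0
  have h2 : Integrable (gaussianProfile : EuclideanSpace ℝ (Fin d) → ℝ) := by
    refine h.norm.congr (ae_of_all _ fun y => ?_)
    simp only [Complex.norm_exp, gaussianProfile]
    congr 1
    norm_cast
    simp
  rw [← ofReal_integral_eq_lintegral_ofReal h2 (ae_of_all _ fun y => (Real.exp_pos _).le)]
  exact ENNReal.ofReal_lt_top

theorem lintegral_gaussianProfile_pos {d : ℕ} :
    0 < ∫⁻ y : EuclideanSpace ℝ (Fin d), ENNReal.ofReal (gaussianProfile y) := by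
  rw [lintegral_pos_iff_support measurable_gaussianProfile.ennreal_ofReal]
  have : Function.support (fun y : EuclideanSpace ℝ (Fin d) =>
      ENNReal.ofReal (gaussianProfile y)) = Set.univ := by
    ext y
    simp [gaussianProfile, Real.exp_pos]
  rw [this]
  exact Measure.measure_univ_pos.2 (NeZero.ne _)

theorem tendsto_lintegral_rescaledProfile {d : ℕ} :
    Tendsto (fun s : ℝ => ∫⁻ y : EuclideanSpace ℝ (Fin d), ENNReal.ofReal (rescaledProfile s y))
      atTop (𝓝 (∫⁻ y : EuclideanSpace ℝ (Fin d), ENNReal.ofReal (gaussianProfile y))) := by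
  refine tendsto_lintegral_filter_of_dominated_convergence
    (fun y => ENNReal.ofReal (gaussianProfile y))
    (Eventually.of_forall fun s => (measurable_rescaledProfile s).ennreal_ofReal) ?_
    lintegral_gaussianProfile_lt_top.ne
    (ae_of_all _ fun y => ENNReal.tendsto_ofReal (tendsto_rescaledProfile y))
  filter_upwards [eventually_gt_atTop 0] with s hs
  exact ae_of_all _ fun y => ENNReal.ofReal_le_ofReal (rescaledProfile_le_gaussianProfile hs y)

theorem lintegral_liftProfile_lt_top {d : ℕ} {s : ℝ} (hs : 0 < s) :
    ∫⁻ y : EuclideanSpace ℝ (Fin d), ENNReal.ofReal (liftProfile s y) < ∞ := by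
  have h : ∀ y : EuclideanSpace ℝ (Fin d), ENNReal.ofReal (liftProfile s y) ≤
      (Metric.closedBall (0 : EuclideanSpace ℝ (Fin d)) 1).indicator (fun _ => 1) y := by
    intro y
    by_cases hy : y ∈ Metric.closedBall (0 : EuclideanSpace ℝ (Fin d)) 1
    · rw [Set.indicator_of_mem hy]
      exact ENNReal.ofReal_le_one.2 (liftProfile_le_one hs y)
    · rw [mem_closedBall_zero_iff, not_le] at hy
      rw [liftProfile_eq_zero hs hy, ENNReal.ofReal_zero]
      exact zero_le
  refine (lintegral_mono h).trans_lt ?_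
  rw [lintegral_indicator measurableSet_closedBall, setLIntegral_one]
  exact measure_closedBall_lt_top

theorem lintegral_liftProfile_pos {d : ℕ} {s : ℝ} (hs : 0 < s) :
    0 < ∫⁻ y : EuclideanSpace ℝ (Fin d), ENNReal.ofReal (liftProfile s y) := by
  rw [lintegral_pos_iff_support (measurable_liftProfile s).ennreal_ofReal]
  refine (Metric.measure_closedBall_pos volume (0 : EuclideanSpace ℝ (Fin d))
    (by norm_num : (0 : ℝ) < 3 / 4)).trans_le (measure_mono fun y hy => ?_)
  have h := le_liftProfile hs (mem_closedBall_zero_iff.1 hy)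
  have h2 : 0 < liftProfile s y := (Real.rpow_pos_of_pos (by norm_num) s).trans_le h
  exact (ENNReal.ofReal_pos.2 h2).ne'

/-! ### Ellipsoids and Gaussians as dominated parameters -/

namespace EllipsoidParam

theorem mem_body_iff {d : ℕ} (P : EllipsoidParam d) (x : EuclideanSpace ℝ (Fin d)) (ξ : ℝ) :
    (x, ξ) ∈ P.body ↔
      ‖Matrix.toEuclideanLin P.A⁻¹ (x - P.a)‖ ^ 2 + (ξ / P.α) ^ 2 ≤ 1 := by
  constructor
  · rintro ⟨⟨y, η⟩, hy, h⟩
    rw [Prod.mk.injEq] at h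
    obtain ⟨rfl, rfl⟩ := h
    rw [add_sub_cancel_right, toEuclideanLin_inv_apply P.posDef,
      mul_div_cancel_left₀ _ P.α_pos.ne']
    exact hy
  · intro h
    refine ⟨(Matrix.toEuclideanLin P.A⁻¹ (x - P.a), ξ / P.α), h, ?_⟩
    rw [Prod.mk.injEq]
    refine ⟨?_, mul_div_cancel₀ _ P.α_pos.ne'⟩
    rw [toEuclideanLin_apply_inv P.posDef, sub_add_cancel]

/-- Replace the height `α` by `α ^ s`. -/
noncomputable def powHeight {d : ℕ} (P : EllipsoidParam d) (s : ℝ) : EllipsoidParam d where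
  A := P.A
  α := P.α ^ s
  a := P.a
  posDef := P.posDef
  α_pos := Real.rpow_pos_of_pos P.α_pos s

theorem powHeight_powHeight_inv {d : ℕ} (P : EllipsoidParam d) {s : ℝ} (hs : s ≠ 0) :
    (P.powHeight s).powHeight s⁻¹ = P := by
  cases P with
  | mk A α a hA hα =>
    simp only [powHeight, EllipsoidParam.mk.injEq, true_and, and_true]
    exact Real.rpow_rpow_inv hα.le hs

theorem powHeight_inv_powHeight {d : ℕ} (P : EllipsoidParam d) {s : ℝ} (hs : s ≠ 0) :
    (P.powHeight s⁻¹).powHeight s = P := by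
  have := P.powHeight_powHeight_inv (inv_ne_zero hs)
  rwa [inv_inv] at this

/-- Only the upper boundary of the ellipsoid matters, and `α √(1 - ‖y‖²) ≤ f ^ (1/s)` is raised to
the power `s`. Off the unit ball the profile is `0`. -/
theorem body_subset_sLift_iff {d : ℕ} (P : EllipsoidParam d) {s : ℝ} (hs : 0 < s)
    {f : EuclideanSpace ℝ (Fin d) → ℝ} (hf : ∀ x, 0 ≤ f x) :
    P.body ⊆ sLift s f ↔ (P.powHeight s).Dominated (liftProfile s) f := by
  constructor
  · intro h y
    change P.α ^ s * √(1 - ‖y‖ ^ 2) ^ s ≤ f (Matrix.toEuclideanLin P.A y + P.a)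
    rcases lt_or_ge 1 ‖y‖ with hy | hy
    · rw [Real.sqrt_eq_zero_of_nonpos (by nlinarith), Real.zero_rpow hs.ne', mul_zero]
      exact hf _
    have hy2 : 0 ≤ 1 - ‖y‖ ^ 2 := by nlinarith [norm_nonneg y]
    have hmem : (Matrix.toEuclideanLin P.A y + P.a, P.α * √(1 - ‖y‖ ^ 2)) ∈ P.body := by
      refine ⟨(y, √(1 - ‖y‖ ^ 2)), ?_, rfl⟩
      change ‖y‖ ^ 2 + √(1 - ‖y‖ ^ 2) ^ 2 ≤ 1
      rw [Real.sq_sqrt hy2]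
      linarith
    have h1 : |P.α * √(1 - ‖y‖ ^ 2)| ≤ f (Matrix.toEuclideanLin P.A y + P.a) ^ (1 / s) := h hmem
    have h0 : 0 ≤ P.α * √(1 - ‖y‖ ^ 2) := mul_nonneg P.α_pos.le (Real.sqrt_nonneg _)
    rw [abs_of_nonneg h0, one_div, Real.le_rpow_inv_iff_of_pos h0 (hf _) hs,
      Real.mul_rpow P.α_pos.le (Real.sqrt_nonneg _)] at h1
    exact h1
  · rintro h _ ⟨⟨y, η⟩, hy, rfl⟩
    have hy' : ‖y‖ ^ 2 + η ^ 2 ≤ 1 := hy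
    have h1 : P.α ^ s * √(1 - ‖y‖ ^ 2) ^ s ≤ f (Matrix.toEuclideanLin P.A y + P.a) := h y
    have h0 : 0 ≤ P.α * √(1 - ‖y‖ ^ 2) := mul_nonneg P.α_pos.le (Real.sqrt_nonneg _)
    rw [← Real.mul_rpow P.α_pos.le (Real.sqrt_nonneg _),
      ← Real.le_rpow_inv_iff_of_pos h0 (hf _) hs, ← one_div] at h1
    change |P.α * η| ≤ f (Matrix.toEuclideanLin P.A y + P.a) ^ (1 / s)
    refine le_trans ?_ h1
    rw [abs_mul, abs_of_pos P.α_pos]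
    exact mul_le_mul_of_nonneg_left (Real.abs_le_sqrt (by linarith)) P.α_pos.le

/-- The vertical fibre is a segment of half-length `α √(1 - ‖z‖²)`; the formula also covers empty
fibres, the root of a negative number being `0`. -/
theorem sMarginalDensity_body {d : ℕ} (P : EllipsoidParam d) {s : ℝ} (hs : 0 < s)
    (x : EuclideanSpace ℝ (Fin d)) :
    sMarginalDensity s P.body x = ENNReal.ofReal ((P.powHeight s).α *
      liftProfile s (Matrix.toEuclideanLin (P.powHeight s).A⁻¹ (x - (P.powHeight s).a))) := by
  change _ = ENNReal.ofReal (P.α ^ s *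
    √(1 - ‖Matrix.toEuclideanLin P.A⁻¹ (x - P.a)‖ ^ 2) ^ s)
  set z := Matrix.toEuclideanLin P.A⁻¹ (x - P.a) with hz
  have h0 : 0 ≤ P.α * √(1 - ‖z‖ ^ 2) := mul_nonneg P.α_pos.le (Real.sqrt_nonneg _)
  have hvol : volume {ξ : ℝ | (x, ξ) ∈ P.body} = ENNReal.ofReal (P.α * √(1 - ‖z‖ ^ 2)) * 2 := by
    rcases le_or_gt (‖z‖ ^ 2) 1 with h | h
    · have : {ξ : ℝ | (x, ξ) ∈ P.body} =
          Set.Icc (-(P.α * √(1 - ‖z‖ ^ 2))) (P.α * √(1 - ‖z‖ ^ 2)) := by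
        ext ξ
        rw [Set.mem_Icc, ← abs_le]
        change (x, ξ) ∈ P.body ↔ _
        rw [mem_body_iff, ← hz, mul_comm P.α, ← div_le_iff₀ P.α_pos,
          Real.le_sqrt (div_nonneg (abs_nonneg _) P.α_pos.le) (by linarith), div_pow, div_pow,
          sq_abs]
        constructor <;> intro _ <;> linarith
      rw [this, Real.volume_Icc, sub_neg_eq_add, ← two_mul, mul_comm,
        ENNReal.ofReal_mul' (by norm_num), ENNReal.ofReal_ofNat]
    · have : {ξ : ℝ | (x, ξ) ∈ P.body} = ∅ := by
        ext ξ
        change (x, ξ) ∈ P.body ↔ False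
        rw [mem_body_iff, ← hz, iff_false, not_le]
        nlinarith [sq_nonneg (ξ / P.α)]
      rw [this, measure_empty, Real.sqrt_eq_zero_of_nonpos (by linarith), mul_zero,
        ENNReal.ofReal_zero, zero_mul]
  rw [sMarginalDensity, hvol, ENNReal.mul_div_cancel_right (by norm_num) (by norm_num),
    ENNReal.ofReal_rpow_of_nonneg h0 hs.le, Real.mul_rpow P.α_pos.le (Real.sqrt_nonneg _)]

theorem sVolume_body {d : ℕ} (P : EllipsoidParam d) {s : ℝ} (hs : 0 < s) :
    sVolume s P.body = ENNReal.ofReal (P.powHeight s).weight *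
      ∫⁻ y : EuclideanSpace ℝ (Fin d), ENNReal.ofReal (liftProfile s y) := by
  rw [← weight_lintegral _ (measurable_liftProfile s), sVolume]
  exact lintegral_congr fun x => P.sMarginalDensity_body hs x

theorem sFunction_eq {d : ℕ} (P : EllipsoidParam d) {s : ℝ} (hs : 0 < s)
    (x : EuclideanSpace ℝ (Fin d)) :
    P.sFunction s x = (P.powHeight s).α *
      liftProfile s (Matrix.toEuclideanLin (P.powHeight s).A⁻¹ (x - (P.powHeight s).a)) := by
  rw [sFunction, P.sMarginalDensity_body hs,
    ENNReal.toReal_ofReal (mul_nonneg (P.powHeight s).α_pos.le (liftProfile_nonneg _ _))]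

/-- Raising the height to the power `s` is a bijection of the parameters, and it turns the
`s`-volume into the weight times a positive finite constant. -/
theorem isJohnEllipsoid_iff {d : ℕ} {P : EllipsoidParam d} {s : ℝ} (hs : 0 < s)
    {f : EuclideanSpace ℝ (Fin d) → ℝ} (hf : ∀ x, 0 ≤ f x) :
    IsJohnEllipsoid s f P ↔ (P.powHeight s).IsMaximalDominated (liftProfile s) f := by
  have hvol : ∀ Q : EllipsoidParam d, sVolume s Q.body ≤ sVolume s P.body ↔
      (Q.powHeight s).weight ≤ (P.powHeight s).weight := fun Q => by
    rw [Q.sVolume_body hs, P.sVolume_body hs, ENNReal.mul_le_mul_iff_left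
      (lintegral_liftProfile_pos hs).ne' (lintegral_liftProfile_lt_top hs).ne,
      ENNReal.ofReal_le_ofReal_iff (weight_pos _).le]
  rw [IsJohnEllipsoid, P.body_subset_sLift_iff hs hf, IsMaximalDominated]
  refine and_congr_right fun _ => ⟨fun h Q hQ => ?_, fun h Q hQ => ?_⟩
  · have := (hvol (Q.powHeight s⁻¹)).1 (h _ ((body_subset_sLift_iff _ hs hf).2 (by
      rwa [Q.powHeight_inv_powHeight hs.ne'])))
    rwa [Q.powHeight_inv_powHeight hs.ne'] at this
  · exact (hvol Q).2 (h _ ((Q.body_subset_sLift_iff hs hf).1 hQ))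

theorem exists_dominated_liftProfile {d : ℕ} {s : ℝ} (hs : 0 < s)
    {f : EuclideanSpace ℝ (Fin d) → ℝ} (hf : IsProperLogConcave f) :
    ∃ P : EllipsoidParam d, P.Dominated (liftProfile s) f := by
  obtain ⟨x₀, r, m, hr, hm, hball⟩ := hf.exists_pos_closedBall
  refine ⟨⟨r • 1, m, x₀, Matrix.PosDef.one.smul hr, hm⟩, fun y => ?_⟩
  rcases lt_or_ge 1 ‖y‖ with hy | hy
  · rw [liftProfile_eq_zero hs hy, mul_zero]
    exact hf.logConcave.1 _
  · refine (mul_le_of_le_one_right hm.le (liftProfile_le_one hs y)).trans (hball _ ?_)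
    rw [mem_closedBall_iff_norm]
    simp only [map_smul, Matrix.toLpLin_one, LinearMap.smul_apply, LinearMap.id_apply,
      add_sub_cancel_right, norm_smul, Real.norm_of_nonneg hr.le]
    exact mul_le_of_le_one_right hr.le hy

theorem existsUnique_isJohnEllipsoid {d : ℕ} {s : ℝ} (hs : 0 < s)
    {f : EuclideanSpace ℝ (Fin d) → ℝ} (hf : IsProperLogConcave f) :
    ∃! E : EllipsoidParam d, IsJohnEllipsoid s f E := by
  have h0 := hf.logConcave.1
  obtain ⟨P₀, hP₀⟩ := exists_dominated_liftProfile hs hf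
  obtain ⟨P, hP⟩ := exists_isMaximalDominated hf (φ := liftProfile s)
    (Real.rpow_pos_of_pos (by norm_num : (0 : ℝ) < 1 / 2) s) (fun y hy => le_liftProfile hs hy) hP₀
  refine ⟨P.powHeight s⁻¹, (isJohnEllipsoid_iff hs h0).2 ?_, fun Q hQ => ?_⟩
  · rwa [P.powHeight_inv_powHeight hs.ne']
  · rw [← ((isJohnEllipsoid_iff hs h0).1 hQ).eq hf.logConcave (liftProfile_nonneg s)
      (fun y hy => liftProfile_eq_zero hs hy) hP, Q.powHeight_powHeight_inv hs.ne']

/-! ### Dilating the profile -/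

/-- Replace the matrix `A` by `c A`. -/
noncomputable def dilate {d : ℕ} (P : EllipsoidParam d) (c : ℝ) (hc : 0 < c) :
    EllipsoidParam d where
  A := c • P.A
  α := P.α
  a := P.a
  posDef := P.posDef.smul hc
  α_pos := P.α_pos

theorem weight_dilate {d : ℕ} (P : EllipsoidParam d) {c : ℝ} (hc : 0 < c) :
    (P.dilate c hc).weight = c ^ d * P.weight := by
  simp only [weight, dilate, Matrix.det_smul, Fintype.card_fin]
  ring

theorem smul_inv_dilate {d : ℕ} (P : EllipsoidParam d) {c : ℝ} (hc : 0 < c)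
    (z : EuclideanSpace ℝ (Fin d)) :
    c • Matrix.toEuclideanLin (P.dilate c hc).A⁻¹ z = Matrix.toEuclideanLin P.A⁻¹ z := by
  have h := toEuclideanLin_apply_inv (P.dilate c hc).posDef z
  have h2 : Matrix.toEuclideanLin (P.dilate c hc).A
      (Matrix.toEuclideanLin (P.dilate c hc).A⁻¹ z) =
      Matrix.toEuclideanLin P.A (c • Matrix.toEuclideanLin (P.dilate c hc).A⁻¹ z) := by
    generalize Matrix.toEuclideanLin (P.dilate c hc).A⁻¹ z = w
    simp [dilate]
  rw [h2] at h
  rw [← toEuclideanLin_inv_apply P.posDef (c • _), h]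

theorem dominated_dilate_iff {d : ℕ} (P : EllipsoidParam d) {c : ℝ} (hc : 0 < c)
    {φ f : EuclideanSpace ℝ (Fin d) → ℝ} :
    (P.dilate c hc).Dominated (fun y => φ (c • y)) f ↔ P.Dominated φ f := by
  have h : ∀ y, Matrix.toEuclideanLin (P.dilate c hc).A y = Matrix.toEuclideanLin P.A (c • y) :=
    fun y => by simp [dilate]
  constructor
  · intro hd y
    have := hd (c⁻¹ • y)
    simp only [h, smul_inv_smul₀ hc.ne'] at this
    exact this
  · intro hd y
    rw [h]
    exact hd (c • y)

/-- Dilation is a bijection between the two sets of competitors and multiplies every weight by `cᵈ`.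
-/
theorem IsMaximalDominated.dilate {d : ℕ} {P : EllipsoidParam d} {c : ℝ} (hc : 0 < c)
    {φ f : EuclideanSpace ℝ (Fin d) → ℝ} (hP : P.IsMaximalDominated φ f) :
    (P.dilate c hc).IsMaximalDominated (fun y => φ (c • y)) f := by
  refine ⟨(P.dominated_dilate_iff hc).2 hP.1, fun Q hQ => ?_⟩
  have hdd : (Q.dilate c⁻¹ (inv_pos.2 hc)).dilate c hc = Q := by
    cases Q
    simp [EllipsoidParam.dilate, smul_smul, mul_inv_cancel₀ hc.ne']
  rw [← hdd] at hQ ⊢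
  rw [weight_dilate, P.weight_dilate]
  exact mul_le_mul_of_nonneg_left (hP.2 _ ((dominated_dilate_iff _ hc).1 hQ)) (by positivity)

/-- The John `s`-ellipsoid, rescaled by `√(2 / s)`, maximizes the weight for the rescaled
profile. -/
theorem exists_rescaled_of_isJohnEllipsoid {d : ℕ} {E : EllipsoidParam d} {s : ℝ} (hs : 0 < s)
    {f : EuclideanSpace ℝ (Fin d) → ℝ} (hf : ∀ x, 0 ≤ f x) (hE : IsJohnEllipsoid s f E) :
    ∃ R : EllipsoidParam d, R.IsMaximalDominated (rescaledProfile s) f ∧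
      (∀ x, E.sFunction s x =
        R.α * rescaledProfile s (Matrix.toEuclideanLin R.A⁻¹ (x - R.a))) ∧
      sVolume s E.body = ENNReal.ofReal R.weight *
        ∫⁻ y : EuclideanSpace ℝ (Fin d), ENNReal.ofReal (rescaledProfile s y) := by
  have hc : 0 < √(2 / s) := Real.sqrt_pos.2 (by positivity)
  have hfun : ∀ x, (E.powHeight s).α * liftProfile s
      (Matrix.toEuclideanLin (E.powHeight s).A⁻¹ (x - (E.powHeight s).a)) =
      ((E.powHeight s).dilate _ hc).α * rescaledProfile s (Matrix.toEuclideanLin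
        ((E.powHeight s).dilate _ hc).A⁻¹ (x - ((E.powHeight s).dilate _ hc).a)) := by
    intro x
    rw [rescaledProfile, smul_inv_dilate]
    rfl
  refine ⟨(E.powHeight s).dilate _ hc, ((isJohnEllipsoid_iff hs hf).1 hE).dilate hc, fun x => ?_,
    ?_⟩
  · rw [E.sFunction_eq hs, hfun]
  · rw [← weight_lintegral _ (measurable_rescaledProfile s), sVolume]
    refine lintegral_congr fun x => ?_
    rw [E.sMarginalDensity_body hs, hfun]

/-! ### Gaussian densities and their height -/

theorem gaussian_eq {d : ℕ} (G : EllipsoidParam d) (x : EuclideanSpace ℝ (Fin d)) :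
    G.gaussian x = G.α * gaussianProfile (Matrix.toEuclideanLin G.A⁻¹ (x - G.a)) := by
  rw [gaussian, gaussianProfile, real_inner_self_eq_norm_sq]

theorem gaussianBelow_iff {d : ℕ} (G : EllipsoidParam d) {f : EuclideanSpace ℝ (Fin d) → ℝ} :
    G.GaussianBelow f ↔ G.Dominated gaussianProfile f := by
  constructor
  · intro h y
    have := h (Matrix.toEuclideanLin G.A y + G.a)
    rwa [gaussian_eq, add_sub_cancel_right, toEuclideanLin_inv_apply G.posDef] at this
  · intro h x
    have := h (Matrix.toEuclideanLin G.A⁻¹ (x - G.a))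
    rwa [toEuclideanLin_apply_inv G.posDef, sub_add_cancel, ← gaussian_eq] at this

theorem integral_gaussian {d : ℕ} (G : EllipsoidParam d) :
    ∫ x, G.gaussian x = G.weight *
      (∫⁻ y : EuclideanSpace ℝ (Fin d), ENNReal.ofReal (gaussianProfile y)).toReal := by
  have hm : Measurable (fun x => G.gaussian x) := by
    have hL : Measurable (Matrix.toEuclideanLin G.A⁻¹) :=
      (LinearMap.continuous_of_finiteDimensional _).measurable
    simp only [gaussian_eq]
    exact (measurable_gaussianProfile.comp (hL.comp (measurable_id.sub_const _))).const_mul _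
  have h0 : ∀ x, 0 ≤ G.gaussian x := fun x => mul_nonneg G.α_pos.le (Real.exp_pos _).le
  rw [integral_eq_lintegral_of_nonneg_ae (ae_of_all _ h0) hm.aestronglyMeasurable]
  simp only [gaussian_eq]
  rw [weight_lintegral _ measurable_gaussianProfile, ENNReal.toReal_mul,
    ENNReal.toReal_ofReal G.weight_pos.le]

theorem isMaximalGaussian_iff {d : ℕ} (G : EllipsoidParam d)
    {f : EuclideanSpace ℝ (Fin d) → ℝ} :
    G.IsMaximalGaussian f ↔ G.IsMaximalDominated gaussianProfile f := by
  have hpos := ENNReal.toReal_pos (lintegral_gaussianProfile_pos (d := d)).ne'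
    lintegral_gaussianProfile_lt_top.ne
  simp only [IsMaximalGaussian, IsMaximalDominated, gaussianBelow_iff, integral_gaussian,
    mul_le_mul_iff_left₀ hpos]

/-- A maximal Gaussian density below `f` has height at least `2⁻ᵈ ‖f‖`. -/
theorem IsMaximalDominated.le_two_pow_mul {d : ℕ} {G : EllipsoidParam d}
    {f : EuclideanSpace ℝ (Fin d) → ℝ} (hf : IsLogConcave f)
    (hG : G.IsMaximalDominated gaussianProfile f) (x : EuclideanSpace ℝ (Fin d)) :
    f x ≤ 2 ^ d * G.α := by
  rcases (hf.1 x).eq_or_lt with h0 | h0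
  · rw [← h0]
    exact mul_nonneg (by positivity) G.α_pos.le
  have hc : 0 < √(1 / 2 : ℝ) := Real.sqrt_pos.2 (by norm_num)
  have hc2 : √(1 / 2 : ℝ) ^ 2 = 1 / 2 := Real.sq_sqrt (by norm_num)
  -- The square root of the product of the Gaussian at `A w + a` and the value `f x`, placed at the
  -- midpoint. Halving the points and halving the exponent together scale `A` by `(1/2) √2 =
  -- √(1/2)`; hence `w = √2 y` below. Comparing weights gives `√(α f(x)) 2^(-d/2) ≤ α`.
  let R : EllipsoidParam d := ⟨√(1 / 2 : ℝ) • G.A, √(G.α * f x),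
    (1 / 2 : ℝ) • (G.a + x), G.posDef.smul hc, Real.sqrt_pos.2 (mul_pos G.α_pos h0)⟩
  have hR : R.Dominated gaussianProfile f := by
    intro y
    set w := (2 * √(1 / 2 : ℝ)) • y with hw
    have hwn : ‖w‖ ^ 2 = 2 * ‖y‖ ^ 2 := by
      rw [hw, norm_smul, mul_pow, Real.norm_of_nonneg (by positivity), mul_pow, hc2]
      ring
    have h := hf.rpow_mul_rpow_le (t := 1 / 2) (mul_pos G.α_pos (Real.exp_pos _)).le h0.le
      (hG.1 w) le_rfl (by norm_num) (by norm_num)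
    have h1 : (1 - 1 / 2 : ℝ) = 1 / 2 := by norm_num
    have hexp : Real.exp (-‖w‖ ^ 2) = Real.exp (-‖y‖ ^ 2) ^ 2 := by
      rw [← Real.exp_nat_mul]
      congr 1
      push_cast
      linarith
    rw [h1, ← Real.sqrt_eq_rpow, ← Real.sqrt_eq_rpow,
      ← Real.sqrt_mul (mul_pos G.α_pos (Real.exp_pos _)).le, hexp,
      show G.α * Real.exp (-‖y‖ ^ 2) ^ 2 * f x = G.α * f x * Real.exp (-‖y‖ ^ 2) ^ 2 by ring,
      Real.sqrt_mul (mul_pos G.α_pos h0).le, Real.sqrt_sq (Real.exp_pos _).le] at h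
    have heq : Matrix.toEuclideanLin R.A y + R.a =
        (1 / 2 : ℝ) • (Matrix.toEuclideanLin G.A w + G.a) + (1 / 2 : ℝ) • x := by
      simp only [R, hw, map_smul, LinearMap.smul_apply]
      module
    rw [heq]
    exact h
  have hle := hG.2 R hR
  have h1 : √(G.α * f x) * √(1 / 2 : ℝ) ^ d ≤ G.α := by
    have : R.weight = √(G.α * f x) * √(1 / 2 : ℝ) ^ d * G.A.det := by
      simp only [weight, R, Matrix.det_smul, Fintype.card_fin]
      ring
    rw [this, weight] at hle
    exact le_of_mul_le_mul_right hle G.posDef.det_pos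
  have h2 := pow_le_pow_left₀ (by positivity) h1 2
  rw [mul_pow, Real.sq_sqrt (mul_pos G.α_pos h0).le, ← pow_mul, mul_comm d 2, pow_mul, hc2, sq,
    mul_assoc] at h2
  have h3 := le_of_mul_le_mul_left h2 G.α_pos
  rw [one_div, inv_pow, ← div_eq_mul_inv, div_le_iff₀ (by positivity)] at h3
  linarith

end EllipsoidParam

/-! ### Uniform convergence of Gaussians and the limit `s → ∞` -/

/-- The difference is at most `exp (-min p q) * |q - p|`. As `δ ≤ 1/2`, `min p q ≥ (p - 1)/2`, and
the exponential absorbs the factor `1 + p`. A relative error is allowed because errors in `‖z‖²`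
grow with `z`. -/
theorem abs_exp_neg_sub_le_of_le {p q δ : ℝ} (hp : 0 ≤ p) (hδ : δ ≤ 1 / 2)
    (hq : |q - p| ≤ δ * (1 + p)) : |Real.exp (-q) - Real.exp (-p)| ≤ 4 * δ := by
  have hδ0 : 0 ≤ δ := by
    by_contra! h
    nlinarith [abs_nonneg (q - p)]
  have hmin : ∀ a b : ℝ, a ≤ b → p / 2 - 1 / 2 ≤ a → |b - a| ≤ δ * (1 + p) →
      |Real.exp (-b) - Real.exp (-a)| ≤ 4 * δ := by
    intro a b hab ha hba
    have h1 : Real.exp (-b) ≤ Real.exp (-a) := Real.exp_le_exp.2 (by linarith)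
    rw [abs_of_nonneg (by linarith)] at hba
    rw [abs_of_nonpos (by linarith), neg_sub]
    have h2 : Real.exp (-b) = Real.exp (-a) * Real.exp (-(b - a)) := by
      rw [← Real.exp_add]; congr 1; ring
    have h3 := Real.add_one_le_exp (-(b - a))
    have h4 : Real.exp (-a) - Real.exp (-b) ≤ Real.exp (-a) * (b - a) := by
      rw [h2]; nlinarith [Real.exp_pos (-a)]
    have h5 : Real.exp (-a) * (1 + p) ≤ 4 := by
      have h6 : 1 + p ≤ 2 * Real.exp (p / 2) := by
        have := Real.add_one_le_exp (p / 2); linarith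
      have h7 : Real.exp (-a) ≤ Real.exp (1 / 2) * Real.exp (-(p / 2)) := by
        rw [← Real.exp_add]; exact Real.exp_le_exp.2 (by linarith)
      have h8 : Real.exp (1 / 2) ≤ 2 := by
        have h9 : Real.exp (1 / 2) ^ 2 ≤ 2 ^ 2 := by
          rw [← Real.exp_nat_mul]
          norm_num
          linarith [Real.exp_one_lt_d9]
        exact le_of_sq_le_sq h9 (by norm_num)
      have h10 : Real.exp (-(p / 2)) * Real.exp (p / 2) = 1 := by
        rw [← Real.exp_add, neg_add_cancel, Real.exp_zero]
      calc Real.exp (-a) * (1 + p)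
          ≤ (Real.exp (1 / 2) * Real.exp (-(p / 2))) * (2 * Real.exp (p / 2)) :=
            mul_le_mul h7 h6 (by linarith) (by positivity)
        _ = 2 * Real.exp (1 / 2) * (Real.exp (-(p / 2)) * Real.exp (p / 2)) := by ring
        _ ≤ 4 := by rw [h10]; linarith
    calc Real.exp (-a) - Real.exp (-b) ≤ Real.exp (-a) * (b - a) := h4
      _ ≤ Real.exp (-a) * (δ * (1 + p)) := mul_le_mul_of_nonneg_left hba (Real.exp_pos _).le
      _ = δ * (Real.exp (-a) * (1 + p)) := by ring
      _ ≤ δ * 4 := mul_le_mul_of_nonneg_left h5 hδ0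
      _ = 4 * δ := by ring
  have hδp : δ * (1 + p) ≤ p / 2 + 1 / 2 := by nlinarith
  rcases le_total p q with h | h
  · exact hmin p q h (by linarith) hq
  · rw [abs_sub_comm]
    rw [abs_sub_comm] at hq
    refine hmin q p h ?_ hq
    rw [abs_of_nonneg (by linarith)] at hq
    linarith

theorem abs_gaussianProfile_sub_le {d : ℕ} {z w : EuclideanSpace ℝ (Fin d)} {η : ℝ}
    (hη : 2 * η * (2 + η) ≤ 1 / 2) (h : ‖w - z‖ ≤ η * (1 + ‖z‖)) :
    |gaussianProfile w - gaussianProfile z| ≤ 4 * (2 * η * (2 + η)) := by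
  rw [gaussianProfile, gaussianProfile]
  have hη0 : 0 ≤ η := by
    by_contra! h0
    nlinarith [norm_nonneg (w - z), norm_nonneg z]
  refine abs_exp_neg_sub_le_of_le (sq_nonneg _) hη ?_
  have h1 : |‖w‖ - ‖z‖| ≤ η * (1 + ‖z‖) := (abs_norm_sub_norm_le w z).trans h
  have h2 : |‖w‖ ^ 2 - ‖z‖ ^ 2| = |‖w‖ - ‖z‖| * (‖w‖ + ‖z‖) := by
    rw [sq_sub_sq, abs_mul, abs_of_nonneg (by positivity : 0 ≤ ‖w‖ + ‖z‖), mul_comm]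
  have h3 : ‖w‖ + ‖z‖ ≤ (2 + η) * (1 + ‖z‖) := by
    have := le_of_abs_le h1
    linarith
  rw [h2]
  calc |‖w‖ - ‖z‖| * (‖w‖ + ‖z‖) ≤ η * (1 + ‖z‖) * ((2 + η) * (1 + ‖z‖)) :=
        mul_le_mul h1 h3 (by positivity) (by positivity)
    _ = η * (2 + η) * (1 + ‖z‖) ^ 2 := by ring
    _ ≤ η * (2 + η) * (2 * (1 + ‖z‖ ^ 2)) :=
        mul_le_mul_of_nonneg_left (by nlinarith [sq_nonneg (1 - ‖z‖)]) (by positivity)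
    _ = 2 * η * (2 + η) * (1 + ‖z‖ ^ 2) := by ring

theorem tendsto_matrix_inv {d : ℕ} {ι : Type*} {l : Filter ι} {A : ι → Matrix (Fin d) (Fin d) ℝ}
    {A₀ : Matrix (Fin d) (Fin d) ℝ} (hA : Tendsto A l (𝓝 A₀)) (h0 : A₀.det ≠ 0) :
    Tendsto (fun i => (A i)⁻¹) l (𝓝 A₀⁻¹) := by
  simp only [Matrix.inv_def, Ring.inverse_eq_inv']
  have h1 : Tendsto (fun i => (A i).det) l (𝓝 A₀.det) :=
    (continuous_id.matrix_det.tendsto A₀).comp hA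
  have h2 : Tendsto (fun i => (A i).adjugate) l (𝓝 A₀.adjugate) :=
    (continuous_id.matrix_adjugate.tendsto A₀).comp hA
  exact (h1.inv₀ h0).smul h2

-- With `z = Q.A⁻¹ (x - Q.a)` the difference is `(Pᵢ⁻¹ Q - 1) z + Pᵢ⁻¹ (Q.a - aᵢ)`, which is small
-- relative to `1 + ‖z‖` uniformly in `x`.
open scoped Matrix.Norms.L2Operator in
theorem exists_affine_error_bound {d : ℕ} {P : ℕ → EllipsoidParam d} {Q : EllipsoidParam d}
    (hA : Tendsto (fun i => (P i).A) atTop (𝓝 Q.A))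
    (ha : Tendsto (fun i => (P i).a) atTop (𝓝 Q.a)) :
    ∃ η : ℕ → ℝ, Tendsto η atTop (𝓝 0) ∧ ∀ i x,
      ‖Matrix.toEuclideanLin (P i).A⁻¹ (x - (P i).a) - Matrix.toEuclideanLin Q.A⁻¹ (x - Q.a)‖ ≤
        η i * (1 + ‖Matrix.toEuclideanLin Q.A⁻¹ (x - Q.a)‖) := by
  have hinv := tendsto_matrix_inv hA Q.posDef.det_pos.ne'
  have hT : Tendsto (fun i => (P i).A⁻¹ * Q.A - 1) atTop (𝓝 0) := by
    have h1 := (hinv.mul_const Q.A).sub_const 1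
    rwa [Matrix.nonsing_inv_mul _ ((Matrix.isUnit_iff_isUnit_det Q.A).1 Q.posDef.isUnit),
      sub_self] at h1
  have hb : Tendsto (fun i => Matrix.toEuclideanLin (P i).A⁻¹ (Q.a - (P i).a)) atTop (𝓝 0) := by
    have h1 := tendsto_toEuclideanLin_apply hinv (ha.const_sub Q.a)
    rwa [sub_self, map_zero] at h1
  refine ⟨fun i => ‖(P i).A⁻¹ * Q.A - 1‖ + ‖Matrix.toEuclideanLin (P i).A⁻¹ (Q.a - (P i).a)‖, ?_,
    fun i x => ?_⟩
  · have := hT.norm.add hb.norm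
    rwa [norm_zero, norm_zero, add_zero] at this
  · set z := Matrix.toEuclideanLin Q.A⁻¹ (x - Q.a) with hz
    have hx : x - (P i).a = Matrix.toEuclideanLin Q.A z + (Q.a - (P i).a) := by
      rw [hz, toEuclideanLin_apply_inv Q.posDef]
      abel
    have hdecomp : Matrix.toEuclideanLin (P i).A⁻¹ (x - (P i).a) - z =
        Matrix.toEuclideanLin ((P i).A⁻¹ * Q.A - 1) z +
          Matrix.toEuclideanLin (P i).A⁻¹ (Q.a - (P i).a) := by
      rw [hx, map_add, map_sub Matrix.toEuclideanLin, LinearMap.sub_apply, toEuclideanLin_mul_apply,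
        Matrix.toLpLin_one, LinearMap.id_apply]
      abel
    have hop : ‖Matrix.toEuclideanLin ((P i).A⁻¹ * Q.A - 1) z‖ ≤
        ‖(P i).A⁻¹ * Q.A - 1‖ * ‖z‖ := by
      rw [Matrix.cstar_norm_def]
      exact (Matrix.toEuclideanCLM (n := Fin d) (𝕜 := ℝ) ((P i).A⁻¹ * Q.A - 1)).le_opNorm z
    rw [hdecomp]
    refine (norm_add_le _ _).trans ?_
    nlinarith [norm_nonneg z, norm_nonneg ((P i).A⁻¹ * Q.A - 1),
      norm_nonneg (Matrix.toEuclideanLin (P i).A⁻¹ (Q.a - (P i).a))]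

/-- Three errors, each bounded independently of `x`: in the height, in the argument of the Gaussian,
and `4 / s` for replacing the Gaussian by the rescaled profile. -/
theorem tendstoUniformly_gaussian {d : ℕ} {P : ℕ → EllipsoidParam d} {Q : EllipsoidParam d}
    {σ : ℕ → ℝ} (hσ : Tendsto σ atTop atTop) (hA : Tendsto (fun i => (P i).A) atTop (𝓝 Q.A))
    (hα : Tendsto (fun i => (P i).α) atTop (𝓝 Q.α))
    (ha : Tendsto (fun i => (P i).a) atTop (𝓝 Q.a)) :
    TendstoUniformly (fun i x => (P i).α *
      rescaledProfile (σ i) (Matrix.toEuclideanLin (P i).A⁻¹ (x - (P i).a))) Q.gaussian atTop := by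
  obtain ⟨η, hη, hbound⟩ := exists_affine_error_bound hA ha
  have hδ : Tendsto (fun i => 2 * η i * (2 + η i)) atTop (𝓝 0) := by
    have := (hη.const_mul 2).mul (hη.const_add 2)
    simpa using this
  have hB : Tendsto (fun i => |(P i).α - Q.α| + (P i).α * (4 * (2 * η i * (2 + η i)) + 4 / σ i))
      atTop (𝓝 0) := by
    have h1 : Tendsto (fun i => |(P i).α - Q.α|) atTop (𝓝 0) := by
      have := (hα.sub_const Q.α).abs
      rwa [sub_self, abs_zero] at this
    have h2 : Tendsto (fun i => 4 / σ i) atTop (𝓝 0) := tendsto_const_nhds.div_atTop hσ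
    have := h1.add (hα.mul ((hδ.const_mul 4).add h2))
    simpa using this
  rw [Metric.tendstoUniformly_iff]
  intro ε hε
  filter_upwards [hδ.eventually_lt_const (by norm_num : (0 : ℝ) < 1 / 2),
    hB.eventually_lt_const hε, hσ.eventually_ge_atTop 2] with i hi1 hi2 hi3 x
  refine lt_of_le_of_lt ?_ hi2
  rw [Q.gaussian_eq, dist_comm, Real.dist_eq]
  set z := Matrix.toEuclideanLin Q.A⁻¹ (x - Q.a)
  set w := Matrix.toEuclideanLin (P i).A⁻¹ (x - (P i).a)
  have h1 := abs_gaussianProfile_sub_le hi1.le (hbound i x)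
  have h2 := abs_rescaledProfile_sub_le hi3 w
  have h3 : |gaussianProfile z| ≤ 1 := by
    rw [gaussianProfile, abs_of_pos (Real.exp_pos _)]
    exact Real.exp_le_one_iff.2 (neg_nonpos.2 (sq_nonneg _))
  have hdec : (P i).α * rescaledProfile (σ i) w - Q.α * gaussianProfile z =
      ((P i).α - Q.α) * gaussianProfile z + (P i).α * ((gaussianProfile w - gaussianProfile z) +
        (rescaledProfile (σ i) w - gaussianProfile w)) := by ring
  rw [hdec]
  refine (abs_add_le _ _).trans (add_le_add ?_ ?_)
  · rw [abs_mul]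
    exact mul_le_of_le_one_right (abs_nonneg _) h3
  · rw [abs_mul, abs_of_pos (P i).α_pos]
    exact mul_le_mul_of_nonneg_left ((abs_add_le _ _).trans (add_le_add h1 h2)) (P i).α_pos.le

namespace EllipsoidParam

theorem Dominated.rescaledProfile {d : ℕ} {P : EllipsoidParam d}
    {f : EuclideanSpace ℝ (Fin d) → ℝ} (h : P.Dominated gaussianProfile f) {s : ℝ} (hs : 0 < s) :
    P.Dominated (rescaledProfile s) f := fun y =>
  (mul_le_mul_of_nonneg_left (rescaledProfile_le_gaussianProfile hs y) P.α_pos.le).trans (h y)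

theorem exists_subseq_tendsto_gaussian {d : ℕ} {f : EuclideanSpace ℝ (Fin d) → ℝ}
    (hf : IsProperLogConcave f) {R : ℝ → EllipsoidParam d}
    (hR : ∀ s, 0 < s → (R s).Dominated (_root_.rescaledProfile s) f) {σ : ℕ → ℝ}
    (hσ : Tendsto σ atTop atTop) {c : ℝ} (hc : 0 < c) (hw : ∀ k, c ≤ (R (σ k)).weight) :
    ∃ (Q : EllipsoidParam d) (τ : ℕ → ℕ), Tendsto τ atTop atTop ∧ (∀ k, 0 < σ (τ k)) ∧
      Tendsto (fun k => (R (σ (τ k))).A) atTop (𝓝 Q.A) ∧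
      Tendsto (fun k => (R (σ (τ k))).α) atTop (𝓝 Q.α) ∧
      Tendsto (fun k => (R (σ (τ k))).a) atTop (𝓝 Q.a) ∧
      Tendsto (fun k => (R (σ (τ k))).weight) atTop (𝓝 Q.weight) ∧
      Q.Dominated gaussianProfile f := by
  -- The profiles have a common lower bound only for `s ≥ 40`, so an initial piece of the sequence
  -- is dropped.
  obtain ⟨N, hN⟩ := eventually_atTop.1 (hσ.eventually_ge_atTop 40)
  have h40 : ∀ k, 40 ≤ σ (k + N) := fun k => hN _ (Nat.le_add_left N k)
  have hshift : Tendsto (fun k => k + N) atTop atTop := tendsto_add_atTop_nat N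
  obtain ⟨Q, τ, hτ, hA, hα, ha, hwt, hQ⟩ := exists_subseq_tendsto hf
    (φ := fun k => _root_.rescaledProfile (σ (k + N))) (P := fun k => R (σ (k + N)))
    (by norm_num : (0 : ℝ) < 1 / 10) hc (fun k y hy => le_rescaledProfile (h40 k) hy)
    (fun y => (tendsto_rescaledProfile y).comp (hσ.comp hshift))
    (fun k => hR _ (by linarith [h40 k])) (fun k => hw _)
  exact ⟨Q, fun k => τ k + N, hshift.comp hτ.tendsto_atTop, fun k => by linarith [h40 (τ k)],
    hA, hα, ha, hwt, hQ⟩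

/-- The maximizers for the rescaled profiles subconverge to a maximal Gaussian density, and their
weights converge. -/
theorem exists_isMaximalDominated_gaussian {d : ℕ} {f : EuclideanSpace ℝ (Fin d) → ℝ}
    (hf : IsProperLogConcave f) {R : ℝ → EllipsoidParam d}
    (hR : ∀ s, 0 < s → (R s).IsMaximalDominated (_root_.rescaledProfile s) f)
    (hG : ∃ G : EllipsoidParam d, G.Dominated gaussianProfile f) :
    ∃ (Q : EllipsoidParam d) (σ : ℕ → ℝ), (∀ i, 0 < σ i) ∧ Tendsto σ atTop atTop ∧
      Q.IsMaximalDominated gaussianProfile f ∧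
      Tendsto (fun k => (R (σ k)).A) atTop (𝓝 Q.A) ∧
      Tendsto (fun k => (R (σ k)).α) atTop (𝓝 Q.α) ∧
      Tendsto (fun k => (R (σ k)).a) atTop (𝓝 Q.a) ∧
      Tendsto (fun s => (R s).weight) atTop (𝓝 Q.weight) := by
  obtain ⟨G, hG⟩ := hG
  -- The rescaled profiles lie below the Gaussian one, so every Gaussian below `f` competes for each
  -- `s`. Passed to the limit, this makes `Q` maximal.
  have hle : ∀ P : EllipsoidParam d, P.Dominated gaussianProfile f → ∀ s, 0 < s →
      P.weight ≤ (R s).weight := fun P hP s hs => (hR s hs).2 P (hP.rescaledProfile hs)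
  have hnat : Tendsto (fun k : ℕ => (k : ℝ) + 1) atTop atTop :=
    tendsto_atTop_add_const_right _ _ tendsto_natCast_atTop_atTop
  obtain ⟨Q, τ, hτ, hpos, hA, hα, ha, hwt, hQ⟩ := exists_subseq_tendsto_gaussian hf
    (fun s hs => (hR s hs).1) hnat G.weight_pos fun k => hle G hG _ (by positivity)
  refine ⟨Q, fun k => (τ k : ℝ) + 1, hpos, hnat.comp hτ,
    ⟨hQ, fun P hP => ge_of_tendsto' hwt fun k => hle P hP _ (hpos k)⟩, hA, hα, ha, ?_⟩
  rw [tendsto_order]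
  refine ⟨fun b hb => ?_, fun b hb => ?_⟩
  · filter_upwards [eventually_gt_atTop 0] with s hs
    exact hb.trans_le (hle Q hQ s hs)
  -- If weights stayed at or above some `b > Q.weight` along a sequence, a subsequence would yield a
  -- Gaussian below `f` of weight at least `b`, contradicting maximality of `Q`.
  · by_contra hcon
    rw [not_eventually] at hcon
    obtain ⟨σ, hσ, hσb⟩ := exists_seq_forall_of_frequently hcon
    obtain ⟨P, τ', -, hpos', -, -, -, hwt', hP⟩ := exists_subseq_tendsto_gaussian hf
      (fun s hs => (hR s hs).1) hσ (Q.weight_pos.trans hb) fun k => not_lt.1 (hσb k)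
    have h1 : b ≤ P.weight := ge_of_tendsto' hwt' fun k => not_lt.1 (hσb _)
    have h2 : P.weight ≤ Q.weight := ge_of_tendsto' hwt fun k => hle P hP _ (hpos k)
    linarith

/-- Along a sequence with `c < V s` the weights are at least `c / K`, where `K` is the Gaussian
mass, because the rescaled profiles have mass at most `K`. Compactness then gives the Gaussian. -/
theorem exists_dominated_of_limsup_pos {d : ℕ} {f : EuclideanSpace ℝ (Fin d) → ℝ}
    (hf : IsProperLogConcave f) {R : ℝ → EllipsoidParam d}
    (hR : ∀ s, 0 < s → (R s).IsMaximalDominated (_root_.rescaledProfile s) f) {V : ℝ → ℝ≥0∞}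
    (hV : ∀ s, 0 < s → V s = ENNReal.ofReal (R s).weight *
      ∫⁻ y : EuclideanSpace ℝ (Fin d), ENNReal.ofReal (_root_.rescaledProfile s y))
    (hpos : 0 < limsup V atTop) : ∃ G : EllipsoidParam d, G.Dominated gaussianProfile f := by
  obtain ⟨c, hc0, hc⟩ := exists_between hpos
  set K := ∫⁻ y : EuclideanSpace ℝ (Fin d), ENNReal.ofReal (gaussianProfile y) with hK
  have hKpos : 0 < K := lintegral_gaussianProfile_pos
  have hKtop : K ≠ ∞ := lintegral_gaussianProfile_lt_top.ne
  have hctop : c ≠ ∞ := (hc.trans_le le_top).ne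
  have hfreq : ∃ᶠ s in atTop, c < V s ∧ 0 < s :=
    (frequently_lt_of_lt_limsup isCobounded_le_of_bot hc).and_eventually (eventually_gt_atTop 0)
  obtain ⟨σ, hσ, hσc⟩ := exists_seq_forall_of_frequently hfreq
  have hcK : 0 < (c / K).toReal := ENNReal.toReal_pos (ENNReal.div_pos hc0.ne' hKtop).ne'
    (ENNReal.div_lt_top hctop hKpos.ne').ne
  have hw : ∀ k, (c / K).toReal ≤ (R (σ k)).weight := by
    intro k
    obtain ⟨h1, h2⟩ := hσc k
    have h3 : c ≤ ENNReal.ofReal (R (σ k)).weight * K := by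
      refine h1.le.trans ?_
      rw [hV _ h2]
      exact mul_le_mul_right (lintegral_mono fun y =>
        ENNReal.ofReal_le_ofReal (rescaledProfile_le_gaussianProfile h2 y)) _
    exact ENNReal.toReal_le_of_le_ofReal (weight_pos _).le (ENNReal.div_le_of_le_mul h3)
  obtain ⟨Q, -, -, -, -, -, -, -, hQ⟩ := exists_subseq_tendsto_gaussian hf
    (fun s hs => (hR s hs).1) hσ hcK hw
  exact ⟨Q, hQ⟩

theorem IsMaximalGaussian.eLpNorm_mul_exp_le {d : ℕ} {G : EllipsoidParam d}
    {f : EuclideanSpace ℝ (Fin d) → ℝ} (hf : IsLogConcave f) (hG : G.IsMaximalGaussian f) :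
    eLpNorm f ∞ volume * ENNReal.ofReal (Real.exp (-(d : ℝ))) ≤ ENNReal.ofReal G.α := by
  have hx := ((isMaximalGaussian_iff G).1 hG).le_two_pow_mul hf
  have h2e : (2 : ℝ) ^ d ≤ Real.exp d := by
    rw [← Real.exp_one_pow]
    refine pow_le_pow_left₀ (by norm_num) ?_ d
    have := Real.add_one_le_exp 1
    linarith
  have hnorm : eLpNorm f ∞ volume ≤ ENNReal.ofReal (Real.exp d * G.α) := by
    rw [eLpNorm_exponent_top]
    refine eLpNormEssSup_le_of_ae_bound (ae_of_all _ fun x => ?_)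
    rw [Real.norm_of_nonneg (hf.1 x)]
    exact (hx x).trans (mul_le_mul_of_nonneg_right h2e G.α_pos.le)
  refine (mul_le_mul_left hnorm _).trans ?_
  rw [← ENNReal.ofReal_mul (mul_pos (Real.exp_pos _) G.α_pos).le]
  refine ENNReal.ofReal_le_ofReal (le_of_eq ?_)
  rw [mul_right_comm, ← Real.exp_add, add_neg_cancel, Real.exp_zero, one_mul]

end EllipsoidParam

theorem theorem7p4 {d : ℕ} (f : EuclideanSpace ℝ (Fin d) → ℝ) (hf : IsProperLogConcave f) :
    -- the John `s`-ellipsoids exist and are unique, so that the family `E` below exists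
    (∀ s : ℝ, 0 < s → ∃! E : EllipsoidParam d, IsJohnEllipsoid s f E) ∧
    ∀ E : ℝ → EllipsoidParam d, (∀ s : ℝ, 0 < s → IsJohnEllipsoid s f (E s)) →
      ((∃ G : EllipsoidParam d, G.GaussianBelow f) ↔
        0 < limsup (fun s : ℝ => sVolume s (E s).body) atTop) ∧
      ((∃ G : EllipsoidParam d, G.GaussianBelow f) →
        (limsup (fun s : ℝ => sVolume s (E s).body) atTop < ∞ ∧
          Tendsto (fun s : ℝ => sVolume s (E s).body) atTop
            (𝓝 (limsup (fun s : ℝ => sVolume s (E s).body) atTop))) ∧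
        ∃ (σ : ℕ → ℝ) (G : EllipsoidParam d),
          (∀ i, 0 < σ i) ∧ Tendsto σ atTop atTop ∧ G.IsMaximalGaussian f ∧
          TendstoUniformly (fun i => (E (σ i)).sFunction (σ i)) G.gaussian atTop) ∧
      ((∃ G : EllipsoidParam d, G.GaussianBelow f) →
        ∀ G : EllipsoidParam d, G.IsMaximalGaussian f →
          eLpNorm f ∞ volume * ENNReal.ofReal (Real.exp (-(d : ℝ))) ≤ ENNReal.ofReal G.α) := by
  have h0 := hf.logConcave.1
  refine ⟨fun s hs => EllipsoidParam.existsUnique_isJohnEllipsoid hs hf, fun E hE => ?_⟩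
  have hex : ∀ s : ℝ, ∃ R : EllipsoidParam d, 0 < s → R.IsMaximalDominated (rescaledProfile s) f ∧
      (∀ x, (E s).sFunction s x =
        R.α * rescaledProfile s (Matrix.toEuclideanLin R.A⁻¹ (x - R.a))) ∧
      sVolume s (E s).body = ENNReal.ofReal R.weight *
        ∫⁻ y : EuclideanSpace ℝ (Fin d), ENNReal.ofReal (rescaledProfile s y) := by
    intro s
    by_cases hs : 0 < s
    · obtain ⟨R, hR⟩ := EllipsoidParam.exists_rescaled_of_isJohnEllipsoid hs h0 (hE s hs)
      exact ⟨R, fun _ => hR⟩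
    · exact ⟨E s, fun h => absurd h hs⟩
  choose R hR using hex
  have hmax := fun s hs => (hR s hs).1
  have hvol := fun s hs => (hR s hs).2.2
  -- `L` will be the integral of a maximal Gaussian; being positive and finite, it settles both the
  -- `limsup` criterion and the limit.
  have hlimit : (∃ G : EllipsoidParam d, G.GaussianBelow f) →
      ∃ (L : ℝ≥0∞) (σ : ℕ → ℝ) (G : EllipsoidParam d), 0 < L ∧ L < ∞ ∧
        Tendsto (fun s : ℝ => sVolume s (E s).body) atTop (𝓝 L) ∧
        (∀ i, 0 < σ i) ∧ Tendsto σ atTop atTop ∧ G.IsMaximalGaussian f ∧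
        TendstoUniformly (fun i => (E (σ i)).sFunction (σ i)) G.gaussian atTop := by
    simp only [EllipsoidParam.gaussianBelow_iff]
    intro hG
    obtain ⟨Q, σ, hσ0, hσ, hQ, hA, hα, ha, hw⟩ :=
      EllipsoidParam.exists_isMaximalDominated_gaussian hf hmax hG
    refine ⟨ENNReal.ofReal Q.weight *
      ∫⁻ y : EuclideanSpace ℝ (Fin d), ENNReal.ofReal (gaussianProfile y), σ, Q,
      ENNReal.mul_pos (ENNReal.ofReal_pos.2 Q.weight_pos).ne' lintegral_gaussianProfile_pos.ne',
      ENNReal.mul_lt_top ENNReal.ofReal_lt_top lintegral_gaussianProfile_lt_top, ?_, hσ0, hσ,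
      Q.isMaximalGaussian_iff.2 hQ, ?_⟩
    · have h := ENNReal.Tendsto.mul (ENNReal.tendsto_ofReal hw)
        (Or.inr lintegral_gaussianProfile_lt_top.ne) (tendsto_lintegral_rescaledProfile (d := d))
        (Or.inr ENNReal.ofReal_ne_top)
      refine h.congr' ?_
      filter_upwards [eventually_gt_atTop 0] with s hs
      exact (hvol s hs).symm
    · have hfun : (fun i => (E (σ i)).sFunction (σ i)) = fun i x => (R (σ i)).α *
          rescaledProfile (σ i) (Matrix.toEuclideanLin (R (σ i)).A⁻¹ (x - (R (σ i)).a)) :=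
        funext fun i => funext fun x => (hR _ (hσ0 i)).2.1 x
      rw [hfun]
      exact tendstoUniformly_gaussian hσ hA hα ha
  refine ⟨⟨fun hG => ?_, fun hpos => ?_⟩, fun hG => ?_, fun _ G hG =>
    hG.eLpNorm_mul_exp_le hf.logConcave⟩
  · obtain ⟨L, -, -, hL, -, hlim, -⟩ := hlimit hG
    rwa [hlim.limsup_eq]
  · simp only [EllipsoidParam.gaussianBelow_iff]
    exact EllipsoidParam.exists_dominated_of_limsup_pos hf hmax hvol hpos
  · obtain ⟨L, σ, G, -, hL, hlim, hσ0, hσ, hG', hunif⟩ := hlimit hG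
    rw [hlim.limsup_eq]
    exact ⟨⟨hL, hlim⟩, σ, G, hσ0, hσ, hG', hunif⟩
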